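/- **Conventions.** A tensor $A$ with finite physical index set $I$ and bond dimension $n$ is a family of matrices $A^i\in\mathcal M_n(\mathbb C)$, $i\in I$. It generates, for $N\ge 1$, the vectors $V^{(N)}(A)=\sum_{i_1,\dots,i_N}\operatorname{tr}(A^{i_1}\cdots A^{i_N})\,|i_1,\dots,i_N\rangle$. The tensor $A$ is *normal* if (i) no orthogonal projector $P\neq 0,\mathbb 1$ satisfies $A^iP=PA^iP$ for all $i$, and (ii) the map $\mathcal E(X)=\sum_i A^iXA^{i\dagger}$ has spectral radius $1$, and $1$ is its only eigenvalue of modulus $1$. It is in *canonical form* if, with respect to some orthogonal decomposition of $\mathbb C^n$, one has $A^i=\bigoplus_{k=1}^r\mu_kA^i_k\oplus 0$ for all $i$, with normal tensors $A_k$ and complex numbers $\mu_k\ne0$ ($r=0$ and an absent zero block are allowed; no normalization of the $\mu_k$ is imposed). Normal tensors $A_1,\dots,A_g$ form a *basis of normal tensors* of $A$ if $V^{(N)}(A)$ is a linear combination of $V^{(N)}(A_1),\dots,V^{(N)}(A_g)$ for every $N\ge1$, and $V^{(N)}(A_1),\dots,V^{(N)}(A_g)$ are linearly independent for all sufficiently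 large $N$. Let $M=(M^{ij}_{ab})$, $i,j\in\{1,\dots,d\}$, $a,b\in\{1,\dots,D\}$, be a complex four-index tensor. *Horizontally*, it is the tensor with physical index $(i,j)$ and the $D\times D$ matrices $M^{ij}=(M^{ij}_{ab})_{a,b}$; *vertically*, it is the tensor with physical index $(a,b)$ and the $d\times d$ matrices $M_{ab}=(M^{ij}_{ab})_{i,j}$. It *generates matrix product density operators* if for every $N\ge1$ the operator $\rho^{(N)}(M)=\sum\operatorname{tr}(M^{i_1j_1}\cdots M^{i_Nj_N})\,|i_1,\dots,i_N\rangle\langle j_1,\dots,j_N|$ on $(\mathbb C^d)^{\otimes N}$ is Hermitian and positive semidefinite. **Proposition.** Suppose that $M$ is in canonical form horizontally and generates matrix product density operators. Then $M$ is also in canonical form vertically. Moreover, there exist $g\geq 0$, integers $m_\alpha\ge1$ and $n_\alpha$, diagonal $m_\alpha\times m_\alpha$ matrices $\mu_\alpha$ with strictly positive diagonal entries and tensors $M_\alpha=(M_{\alpha,ab})_{a,b}$ consisting of $n_\alpha\times n_\alpha$ matrices ($\alpha=1,\dots,g$), such that $\{M_\alpha\}_\alpha$ is a basis of normal tensors of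 the vertical tensor $M$, and a linear map $U:\mathbb C^d\to\bigoplus_{\alpha}\mathbb C^{m_\alpha}\otimes\mathbb C^{n_\alpha}$ with $UU^\dagger=\mathbb 1$ (so $U^\dagger$ is an isometry, and $U$ is unitary if there is no vertical zero block), such that for all $a,b$ $$U M_{ab}U^\dagger=\bigoplus_{\alpha}\mu_\alpha\otimes M_{\alpha,ab}\qquad\text{and}\qquad M_{ab}=U^\dagger\,(U M_{ab}U^\dagger)\,U .$$ -/

import Mathlib

open scoped Matrix Kronecker ComplexOrder

noncomputable section

namespace MPDO

/-- A tensor with physical index in `ι` and auxiliary (bond) index in `n`: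
one square matrix `A i` for every value `i` of the physical index. -/
abbrev Tensor (ι n : Type) := ι → Matrix n n ℂ

section general

variable {ι n : Type} [Fintype n] [DecidableEq n]

/-- The matrix product vector generated by `A` on `N` sites, in the product basis of the
`N`-fold tensor product: its `(i₁, …, i_N)` coordinate is `tr (A^{i₁} ⋯ A^{i_N})`. -/
def mpv (A : Tensor ι n) (N : ℕ) : (Fin N → ι) → ℂ :=
  fun i => (List.ofFn fun k => A (i k)).prod.trace

/-- The completely positive map `X ↦ ∑ i, A i * X * (A i)ᴴ` associated with a tensor. -/
def cpm [Fintype ι] (A : Tensor ι n) : Module.End ℂ (Matrix n n ℂ) where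
  toFun X := ∑ i, A i * X * (A i)ᴴ
  map_add' X Y := by simp [Matrix.mul_add, Matrix.add_mul, Finset.sum_add_distrib]
  map_smul' c X := by simp [Finset.smul_sum]

/-- Normal tensors: (i) no orthogonal projector `P` other than `0` and `1` satisfies
`A i * P = P * A i * P` for all `i`; (ii) the spectral radius of the associated completely positive
map is `1`, and `1` is the only eigenvalue of that magnitude.
(The simplicity of the eigenvalue `1` is a consequence of (i).) -/
structure IsNormal [Fintype ι] (A : Tensor ι n) : Prop where
  irreducible : ∀ P : Matrix n n ℂ, P.IsHermitian → P * P = P →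
    (∀ i, A i * P = P * A i * P) → P = 0 ∨ P = 1
  spectralRadius_eq : spectralRadius ℂ (cpm A) = 1
  eq_one_of_norm : ∀ z : ℂ, (cpm A).HasEigenvalue z → ‖z‖ = 1 → z = 1

/-- Canonical form: with respect to some orthogonal decomposition of the bond space, all the
matrices are block diagonal, with blocks `μ k • B k i` for normal tensors `B k` and nonzero numbers
`μ k`, and possibly a zero block. The columns of `V` are an orthonormal basis, adapted to the
decomposition, of the sum of the nonzero blocks; the zero block is the orthogonal complement of
the range of `V`. -/
def IsCanonicalForm [Fintype ι] (A : Tensor ι n) : Prop :=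
  ∃ (r : ℕ) (D : Fin r → ℕ) (μ : Fin r → ℂ) (B : (k : Fin r) → Tensor ι (Fin (D k)))
    (V : Matrix n ((k : Fin r) × Fin (D k)) ℂ),
    Vᴴ * V = 1 ∧ (∀ k, μ k ≠ 0) ∧ (∀ k, IsNormal (B k)) ∧
    ∀ i, A i = V * Matrix.blockDiagonal' (fun k => μ k • B k i) * Vᴴ

/-- The tensors `B j` form a basis of normal tensors of `A`. -/
structure IsBNT [Fintype ι] (A : Tensor ι n) {g : ℕ} {D : Fin g → ℕ}
    (B : (j : Fin g) → Tensor ι (Fin (D j))) : Prop where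
  normal : ∀ j, IsNormal (B j)
  mem_span : ∀ N : ℕ, 1 ≤ N → mpv A N ∈ Submodule.span ℂ (Set.range fun j => mpv (B j) N)
  linearIndependent : ∃ N₀ : ℕ, ∀ N : ℕ, N₀ < N → LinearIndependent ℂ fun j => mpv (B j) N

end general

/-- The four-index tensor `M i j a b`, with physical indices `i` (ket), `j` (bra) and horizontal
bond indices `a`, `b`, read horizontally: physical index `(i, j)`, matrices on the bond space. -/
def horizontal {d D : ℕ} (M : Fin d → Fin d → Fin D → Fin D → ℂ) :
    Tensor (Fin d × Fin d) (Fin D) :=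
  fun p => Matrix.of fun a b => M p.1 p.2 a b

/-- The same tensor read vertically: `(a, b)` is the physical index and the matrices
act on the one-site physical space. -/
def vertical {d D : ℕ} (M : Fin d → Fin d → Fin D → Fin D → ℂ) :
    Tensor (Fin D × Fin D) (Fin d) :=
  fun p => Matrix.of fun i j => M i j p.1 p.2

/-- The operator generated by `M` on `N` sites: its `(i₁ … i_N), (j₁ … j_N)` matrix element is
`tr (M^{i₁ j₁} ⋯ M^{i_N j_N})`. -/
def mpo {d D : ℕ} (M : Fin d → Fin d → Fin D → Fin D → ℂ) (N : ℕ) :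
    Matrix (Fin N → Fin d) (Fin N → Fin d) ℂ :=
  Matrix.of fun i j => mpv (horizontal M) N fun k => (i k, j k)

/-- `M` generates matrix product density operators: all the generated operators are
Hermitian and positive semidefinite (they are not normalized). -/
def GeneratesMPDO {d D : ℕ} (M : Fin d → Fin d → Fin D → Fin D → ℂ) : Prop :=
  ∀ N : ℕ, 1 ≤ N → (mpo M N).PosSemidef

end MPDO

end

/-! Positivity makes the vertical matrices behave like a self-adjoint family. Contracting all sites
but one of `ρ^(N)` with a vector and its conjugate leaves a positive semidefinite combination of the
matrices `M_ab`. The crucial claim (`posGenerated_vertical`) is that such combinations span every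
`M_ab`. Otherwise some functional `φ`, with coefficients `f`, kills all of them but not some `M_ab`.
Put `X = ∑ f_ij M^{ij}`, a combination of the horizontal matrices. Letting the contracting vector
vary and polarizing gives `tr (X M^w) = 0` for every word `w`. The horizontal canonical form makes
this trace pairing nondegenerate: if a block of `X` were nonzero, irreducibility would supply an `a`
in the generated algebra such that `a X` has eigenvalue `1`, although all positive powers of `a X`
are traceless. Hence `X = 0` and `φ` kills every `M_ab`, a contradiction.

The rest concerns a tensor with this spanning property (`PosGenerated`). An invariant projector
commutes with each Hermitian combination, hence with all the matrices, so the tensor splits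
orthogonally into irreducible blocks and a zero block. Each block has positive definite left and
right Perron eigenvectors, and a positive rescaling makes the Perron eigenvalue `1`. A
Cauchy-Schwarz type estimate in the norm weighted by these eigenvectors bounds the eigenvalues of
the mixed transfer map of two blocks by `1` in modulus, with an intertwiner in case of equality. The
same coefficients give positive combinations in both blocks, so the intertwining factor is positive
and the intertwiner is a multiple of a unitary (`PosGenerated.exists_unitary`).

Comparing a block with itself shows that it is normal, with no periodicity. Comparing two blocks
shows that they are either unitarily equivalent or asymptotically orthogonal. Equivalent blocks are
merged into one basis element, with the inverse positive rescalings as weights; inequivalent ones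
have an eventually diagonally dominant Gram matrix, which yields linear independence. -/

namespace MPDO

/-! ### Traces of powers and eigenvalues -/

section TracePow

variable {V : Type*} [AddCommGroup V] [Module ℂ V] [FiniteDimensional ℂ V]

/-- The trace of a power is the sum of the powers of the eigenvalues, with multiplicity. -/
theorem trace_pow_eq_sum (f : Module.End ℂ V) :
    ∃ (s : Finset ℂ) (m : ℂ → ℕ), (∀ z, z ∈ s ↔ f.HasEigenvalue z) ∧ (∀ z ∈ s, 0 < m z) ∧
      ∀ N : ℕ, LinearMap.trace ℂ V (f ^ N) = ∑ z ∈ s, (m z : ℂ) * z ^ N := by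
  classical
  have hds := DirectSum.isInternal_submodule_of_iSupIndep_of_iSup_eq_top
    f.independent_maxGenEigenspace f.iSup_maxGenEigenspace_eq_top
  have hfin : {μ | f.maxGenEigenspace μ ≠ ⊥}.Finite :=
    WellFoundedGT.finite_ne_bot_of_iSupIndep f.independent_maxGenEigenspace
  have hpow : ∀ (μ : ℂ) (N : ℕ), ∀ x ∈ f.maxGenEigenspace μ,
      (f ^ N) x ∈ f.maxGenEigenspace μ := fun μ N =>
    f.mapsTo_maxGenEigenspace_of_comm (Commute.pow_right (Commute.refl f) N) μ
  have htr : ∀ (μ : ℂ) (N : ℕ), LinearMap.trace ℂ _ ((f ^ N).restrict (hpow μ N)) =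
      (Module.finrank ℂ (f.maxGenEigenspace μ) : ℂ) * μ ^ N := by
    intro μ N
    have h1 : ∀ x ∈ f.maxGenEigenspace μ, f x ∈ f.maxGenEigenspace μ :=
      f.mapsTo_maxGenEigenspace_of_comm (Commute.refl _) μ
    have h2 : (f ^ N).restrict (hpow μ N) = (f.restrict h1) ^ N := by
      rw [Module.End.pow_restrict N h1]
    rw [h2]
    clear h2
    -- On the generalized eigenspace `f - μ` is nilpotent and commutes with the powers of `f`, so
    -- every further factor `f` multiplies the trace by `μ`.
    induction N with
    | zero => simp
    | succ N ih =>
      have := f.isNilpotent_restrict_maxGenEigenspace_sub_algebraMap μ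
      have h3 := LinearMap.trace_comp_eq_mul_of_commute_of_isNilpotent μ
        (Commute.pow_left (Commute.refl (f.restrict h1)) N) this
      rw [pow_succ, Module.End.mul_eq_comp, h3, ih, pow_succ]
      ring
  have hev : ∀ z, f.maxGenEigenspace z ≠ ⊥ ↔ f.HasEigenvalue z := by
    intro z
    rw [Module.End.hasEigenvalue_iff, not_iff_not]
    constructor
    · intro h
      rw [eq_bot_iff, ← h]
      exact Module.End.eigenspace_le_maxGenEigenspace
    · intro h
      by_contra hne
      rw [Module.End.maxGenEigenspace_eq] at hne
      exact Module.End.hasEigenvalue_of_hasGenEigenvalue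
        (Module.End.hasGenEigenvalue_iff.2 hne) h
  refine ⟨hfin.toFinset, fun z => Module.finrank ℂ (f.maxGenEigenspace z), ?_, ?_, ?_⟩
  · intro z; simp [hev]
  · intro z hz
    have : f.maxGenEigenspace z ≠ ⊥ := by simpa using hz
    rw [Module.finrank_pos_iff]
    exact Submodule.nontrivial_iff_ne_bot.mpr this
  · intro N
    rw [LinearMap.trace_eq_sum_trace_restrict' hds hfin (fun μ => hpow μ N)]
    exact Finset.sum_congr rfl fun z _ => htr z N

open Polynomial in
/-- If all positive powers of an endomorphism are traceless, its only eigenvalue is zero. -/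
theorem eq_zero_of_hasEigenvalue_of_trace_pow {f : Module.End ℂ V}
    (hf : ∀ N : ℕ, 1 ≤ N → LinearMap.trace ℂ V (f ^ N) = 0) {z : ℂ} (hz : f.HasEigenvalue z) :
    z = 0 := by
  obtain ⟨s, m, hs, hm, htr⟩ := trace_pow_eq_sum f
  have h1 : ∀ q : ℂ[X], ∑ w ∈ s, (m w : ℂ) * (w * q.eval w) = 0 := by
    intro q
    induction q using Polynomial.induction_on' with
    | add p q hp hq =>
      simp only [eval_add, mul_add, Finset.sum_add_distrib, hp, hq, add_zero]
    | monomial k a =>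
      have h2 := htr (k + 1)
      rw [hf _ (by omega)] at h2
      have : ∑ w ∈ s, (m w : ℂ) * (w * (monomial k a).eval w) =
          a * ∑ w ∈ s, (m w : ℂ) * w ^ (k + 1) := by
        rw [Finset.mul_sum]
        refine Finset.sum_congr rfl fun w _ => ?_
        simp only [eval_monomial]
        ring
      rw [this, ← h2, mul_zero]
  -- This polynomial vanishes at every eigenvalue except `z`, so only the term of `z` survives; the
  -- extra factor `w` in `h1` is there because only positive powers are known to be traceless.
  have h2 := h1 (∏ w ∈ s.erase z, (X - C w))
  have hzs : z ∈ s := (hs z).2 hz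
  rw [Finset.sum_eq_single_of_mem z hzs] at h2
  · have h3 : (∏ w ∈ s.erase z, (X - C w)).eval z ≠ 0 := by
      rw [eval_prod, Finset.prod_ne_zero_iff]
      intro w hw
      simpa [sub_eq_zero] using (Finset.ne_of_mem_erase hw).symm
    have h4 : (m z : ℂ) ≠ 0 := by exact_mod_cast (hm z hzs).ne'
    simpa [h3, h4] using h2
  · intro w hw hwz
    have : (∏ w ∈ s.erase z, (X - C w)).eval w = 0 := by
      rw [eval_prod]
      exact Finset.prod_eq_zero (Finset.mem_erase.2 ⟨hwz, hw⟩) (by simp)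
    rw [this]; simp

end TracePow

/-! ### Subspaces as ranges of isometries -/

section Isometry

variable {n : Type} [Fintype n]

/-- Every subspace is the range of an isometry. -/
theorem exists_isometry (p : Submodule ℂ (n → ℂ)) :
    ∃ (m : ℕ) (W : Matrix n (Fin m) ℂ), Wᴴ * W = 1 ∧ ∀ v, v ∈ p ↔ (W * Wᴴ) *ᵥ v = v := by
  let e := WithLp.linearEquiv 2 ℂ (n → ℂ)
  let q : Submodule ℂ (EuclideanSpace ℂ n) := p.comap e.toLinearMap
  let b := stdOrthonormalBasis ℂ q
  refine ⟨Module.finrank ℂ q, Matrix.of fun i k => (b k : EuclideanSpace ℂ n) i, ?_, ?_⟩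
  · ext k l
    have h := orthonormal_iff_ite.1 b.orthonormal k l
    rw [Submodule.coe_inner, PiLp.inner_apply] at h
    simp only [Matrix.mul_apply, Matrix.conjTranspose_apply, Matrix.of_apply, Matrix.one_apply,
      ← h]
    refine Finset.sum_congr rfl fun i _ => ?_
    simp [mul_comm]
  · intro v
    have key : ∀ v, (Matrix.of fun i k => (b k : EuclideanSpace ℂ n) i) *ᵥ v =
        e (∑ k, v k • (b k : EuclideanSpace ℂ n)) := by
      intro v
      ext i
      simp [e, Matrix.mulVec, dotProduct, mul_comm]
    constructor
    · intro hv
      let x : q := ⟨e.symm v, by simpa [q] using hv⟩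
      have hx := congrArg (fun y : q => e (y : EuclideanSpace ℂ n)) (b.sum_repr x)
      simp only [Submodule.coe_sum, Submodule.coe_smul] at hx
      rw [← Matrix.mulVec_mulVec, key]
      refine Eq.trans ?_ (hx.trans (by simp [x]))
      congr 1
      refine Finset.sum_congr rfl fun k _ => ?_
      congr 1
      rw [b.repr_apply_apply, Submodule.coe_inner, PiLp.inner_apply]
      simp [Matrix.mulVec, dotProduct, x, e, mul_comm]
    · intro hv
      rw [← hv, ← Matrix.mulVec_mulVec, key]
      have : (∑ k, ((Matrix.of fun i k => (b k : EuclideanSpace ℂ n) i)ᴴ *ᵥ v) k •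
          (b k : EuclideanSpace ℂ n)) ∈ q :=
        Submodule.sum_mem _ fun k _ => Submodule.smul_mem _ _ (b k).2
      exact this

end Isometry

/-! ### Order and compactness for positive semidefinite matrices -/

section Loewner

variable {n : Type} [Fintype n] [DecidableEq n]

open scoped MatrixOrder in
/-- A positive definite matrix dominates a positive multiple of any Hermitian matrix. -/
theorem exists_pos_posSemidef_sub {Z Y : Matrix n n ℂ} (hZ : Z.PosDef) (hY : Y.IsHermitian) :
    ∃ ε : ℝ, 0 < ε ∧ (Z - (ε : ℂ) • Y).PosSemidef := by
  obtain ⟨δ, hδ, hδZ⟩ : ∃ δ : ℝ, 0 < δ ∧ algebraMap ℝ (Matrix n n ℂ) δ ≤ Z := by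
    cases isEmpty_or_nonempty n with
    | inl h => exact ⟨1, one_pos, le_of_eq (Subsingleton.elim _ _)⟩
    | inr h =>
      obtain ⟨i, hi⟩ := Finite.exists_min hZ.1.eigenvalues
      refine ⟨hZ.1.eigenvalues i, hZ.eigenvalues_pos i, ?_⟩
      rw [algebraMap_le_iff_le_spectrum (ha := hZ.1)]
      intro x hx
      rw [hZ.1.spectrum_real_eq_range_eigenvalues] at hx
      obtain ⟨j, rfl⟩ := hx
      exact hi j
  obtain ⟨C, hC, hYC⟩ : ∃ C : ℝ, 0 < C ∧ Y ≤ algebraMap ℝ (Matrix n n ℂ) C := by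
    obtain ⟨C, hC⟩ := (Set.finite_range hY.eigenvalues).bddAbove
    refine ⟨max C 1, by positivity, ?_⟩
    rw [le_algebraMap_iff_spectrum_le (ha := hY)]
    intro x hx
    rw [hY.spectrum_real_eq_range_eigenvalues] at hx
    exact (hC hx).trans (le_max_left _ _)
  -- `Z ≥ δ = (δ / C) * C ≥ (δ / C) • Y` in the Loewner order.
  refine ⟨δ / C, by positivity, ?_⟩
  rw [Matrix.le_iff] at hδZ hYC
  have h1 : ((δ / C : ℝ) : ℂ) • (algebraMap ℝ (Matrix n n ℂ) C) = algebraMap ℝ _ δ := by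
    rw [Algebra.algebraMap_eq_smul_one, Algebra.algebraMap_eq_smul_one]
    rw [Complex.coe_smul, smul_smul, div_mul_cancel₀ _ hC.ne']
  have h2 := hYC.smul (show (0 : ℂ) ≤ ((δ / C : ℝ) : ℂ) by
    exact_mod_cast (by positivity : 0 ≤ δ / C))
  have h3 := hδZ.add h2
  rw [smul_sub, h1] at h3
  simpa using h3

omit [DecidableEq n] in
theorem posDef_of_ker {X : Matrix n n ℂ} (hX : X.PosSemidef)
    (h : ∀ v, X *ᵥ v = 0 → v = 0) : X.PosDef := by
  refine Matrix.PosDef.of_dotProduct_mulVec_pos hX.1 fun v hv => ?_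
  refine lt_of_le_of_ne (hX.dotProduct_mulVec_nonneg v) fun h0 => hv (h v ?_)
  exact (hX.dotProduct_mulVec_zero_iff v).1 h0.symm

omit [DecidableEq n] in
theorem isClosed_posSemidef : IsClosed {X : Matrix n n ℂ | X.PosSemidef} := by
  simp only [Matrix.posSemidef_iff_dotProduct_mulVec, Set.ofPred_and, Set.ofPred_forall]
  refine IsClosed.inter ?_ (isClosed_iInter fun v => ?_)
  · exact isClosed_eq (by fun_prop) continuous_id
  · refine isClosed_le continuous_const ?_
    exact Continuous.dotProduct continuous_const (Continuous.matrix_mulVec continuous_id continuous_const)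

omit [DecidableEq n] in
theorem isCompact_trace_mul_conjTranspose_eq_one :
    IsCompact {C : Matrix n n ℂ | (C * Cᴴ).trace = 1} := by
  refine IsCompact.of_isClosed_subset (isCompact_univ_pi fun _ : n => isCompact_univ_pi
    fun _ : n => isCompact_closedBall (0 : ℂ) 1) (isClosed_eq (by fun_prop) continuous_const) ?_
  intro C hC i _ j _
  have h1 : ∑ i, ∑ j, ‖C i j‖ ^ 2 = 1 := by
    have h2 : (C * Cᴴ).trace = ((∑ i, ∑ j, ‖C i j‖ ^ 2 : ℝ) : ℂ) := by
      simp [Matrix.trace, Matrix.mul_apply, Complex.mul_conj, Complex.normSq_eq_norm_sq]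
    rw [hC.out] at h2
    exact_mod_cast h2.symm
  have h3 : ‖C i j‖ ^ 2 ≤ 1 := by
    rw [← h1]
    refine le_trans ?_ (Finset.single_le_sum (f := fun i => ∑ j, ‖C i j‖ ^ 2)
      (fun _ _ => by positivity) (Finset.mem_univ i))
    exact Finset.single_le_sum (f := fun j => ‖C i j‖ ^ 2) (fun _ _ => by positivity)
      (Finset.mem_univ j)
  rw [mem_closedBall_zero_iff]
  exact (sq_le_one_iff₀ (norm_nonneg _)).1 h3

end Loewner

/-! ### Irreducible tensors -/

section Irreducible

variable {ι n : Type} [Fintype n] [DecidableEq n]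

/-- No nontrivial orthogonal projector is invariant under all the matrices of the tensor. -/
def IsIrreducible (A : Tensor ι n) : Prop :=
  ∀ P : Matrix n n ℂ, P.IsHermitian → P * P = P → (∀ i, A i * P = P * A i * P) → P = 0 ∨ P = 1

/-- If `P` is invariant under the adjoints, then `1 - P` is invariant under the tensor itself. -/
theorem IsIrreducible.conjTranspose {A : Tensor ι n} (hA : IsIrreducible A) :
    IsIrreducible fun i => (A i)ᴴ := by
  intro P hP hPP h
  have h1 : ∀ i, P * A i = P * A i * P := by
    intro i
    have := congrArg Matrix.conjTranspose (h i)
    simpa [hP.eq, Matrix.mul_assoc] using this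
  rcases hA (1 - P) (Matrix.isHermitian_one.sub hP) (by simp [sub_mul, mul_sub, hPP])
    (fun i => by
      simp only [sub_mul, mul_sub, one_mul, mul_one, ← h1 i]
      abel) with h2 | h2
  · exact Or.inr (sub_eq_zero.1 h2).symm
  · exact Or.inl (by simpa using h2)

theorem IsIrreducible.eq_bot_or_eq_top {A : Tensor ι n} (hA : IsIrreducible A)
    (p : Submodule ℂ (n → ℂ)) (hp : ∀ i, ∀ v ∈ p, A i *ᵥ v ∈ p) : p = ⊥ ∨ p = ⊤ := by
  obtain ⟨m, W, hW, hpW⟩ := exists_isometry p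
  have hPP : W * Wᴴ * (W * Wᴴ) = W * Wᴴ := by
    rw [Matrix.mul_assoc, ← Matrix.mul_assoc Wᴴ, hW, Matrix.one_mul]
  rcases hA (W * Wᴴ) (Matrix.isHermitian_mul_conjTranspose_self W) hPP (fun i => by
    apply Matrix.ext_of_mulVec_single
    intro j
    have h1 : (W * Wᴴ) *ᵥ Pi.single j 1 ∈ p := by
      rw [hpW, Matrix.mulVec_mulVec, hPP]
    have h2 := (hpW _).1 (hp i _ h1)
    rw [← Matrix.mulVec_mulVec, ← h2, Matrix.mulVec_mulVec, Matrix.mulVec_mulVec,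
      Matrix.mul_assoc]) with h | h
  · left
    rw [eq_bot_iff]
    intro v hv
    rw [hpW, h] at hv
    simpa using hv.symm
  · right
    rw [eq_top_iff]
    intro v _
    rw [hpW, h]
    simp

end Irreducible

/-! ### Perron-Frobenius theory for completely positive maps -/

section PerronFrobenius

variable {ι n : Type} [Fintype ι] [Fintype n] [DecidableEq n]

theorem cpm_apply (A : Tensor ι n) (X : Matrix n n ℂ) : cpm A X = ∑ i, A i * X * (A i)ᴴ := rfl

theorem cpm_posSemidef (A : Tensor ι n) {X : Matrix n n ℂ} (hX : X.PosSemidef) :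
    (cpm A X).PosSemidef :=
  Matrix.posSemidef_sum _ fun i _ => hX.mul_mul_conjTranspose_same (A i)

/-- The quadratic form of `cpm A X` at `v` is a sum of nonnegative terms, the form of `X` at each
`(A i)ᴴ v`, so it vanishes only if every term does. -/
theorem cpm_mulVec_eq_zero_iff (A : Tensor ι n) {X : Matrix n n ℂ} (hX : X.PosSemidef)
    (v : n → ℂ) : cpm A X *ᵥ v = 0 ↔ ∀ i, X *ᵥ ((A i)ᴴ *ᵥ v) = 0 := by
  rw [← (cpm_posSemidef A hX).dotProduct_mulVec_zero_iff, cpm_apply, Matrix.sum_mulVec,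
    dotProduct_sum]
  have h : ∀ i, star v ⬝ᵥ (A i * X * (A i)ᴴ) *ᵥ v =
      star ((A i)ᴴ *ᵥ v) ⬝ᵥ X *ᵥ ((A i)ᴴ *ᵥ v) := by
    intro i
    rw [Matrix.star_mulVec, Matrix.conjTranspose_conjTranspose, ← Matrix.dotProduct_mulVec,
      Matrix.mulVec_mulVec, Matrix.mulVec_mulVec, Matrix.mul_assoc]
  simp only [h]
  rw [Finset.sum_eq_zero_iff_of_nonneg fun i _ => hX.dotProduct_mulVec_nonneg _]
  simp only [Finset.mem_univ, true_imp_iff, hX.dotProduct_mulVec_zero_iff]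

omit [DecidableEq n] in
theorem mulVec_add_eq_zero_iff {X Y : Matrix n n ℂ} (hX : X.PosSemidef) (hY : Y.PosSemidef)
    (v : n → ℂ) : (X + Y) *ᵥ v = 0 ↔ X *ᵥ v = 0 ∧ Y *ᵥ v = 0 := by
  rw [← (hX.add hY).dotProduct_mulVec_zero_iff, Matrix.add_mulVec, dotProduct_add,
    add_eq_zero_iff_of_nonneg (hX.dotProduct_mulVec_nonneg v) (hY.dotProduct_mulVec_nonneg v),
    hX.dotProduct_mulVec_zero_iff, hY.dotProduct_mulVec_zero_iff]

theorem one_add_cpm_pow_posSemidef (A : Tensor ι n) {X : Matrix n n ℂ} (hX : X.PosSemidef)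
    (k : ℕ) : (((1 + cpm A) ^ k) X).PosSemidef := by
  induction k with
  | zero => simpa
  | succ k ih =>
    rw [pow_succ', Module.End.mul_apply, LinearMap.add_apply, Module.End.one_apply]
    exact ih.add (cpm_posSemidef A ih)

/-- Iterating an irreducible completely positive map improves positivity. -/
theorem IsIrreducible.exists_pow_posDef {A : Tensor ι n} (hA : IsIrreducible A)
    {X : Matrix n n ℂ} (hX : X.PosSemidef) (hX0 : X ≠ 0) :
    ∃ k : ℕ, (((1 + cpm A) ^ k) X).PosDef := by
  obtain ⟨m, hm⟩ : ∃ m, Module.finrank ℂ (LinearMap.ker X.mulVecLin) = m := ⟨_, rfl⟩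
  induction m using Nat.strong_induction_on generalizing X with
  | _ m ih =>
    by_cases hker : ∀ v, X *ᵥ v = 0 → v = 0
    · exact ⟨0, by simpa using posDef_of_ker hX hker⟩
    have hY : (X + cpm A X).PosSemidef := hX.add (cpm_posSemidef A hX)
    have hle : LinearMap.ker (X + cpm A X).mulVecLin ≤ LinearMap.ker X.mulVecLin := by
      intro v hv
      simp only [LinearMap.mem_ker, Matrix.mulVecLin_apply] at hv ⊢
      exact ((mulVec_add_eq_zero_iff hX (cpm_posSemidef A hX) v).1 hv).1
    have hX' : ¬ (LinearMap.ker X.mulVecLin = ⊤) := by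
      intro h
      refine hX0 (Matrix.ext_of_mulVec_single fun j => ?_)
      have : Pi.single j (1 : ℂ) ∈ LinearMap.ker X.mulVecLin := h ▸ Submodule.mem_top
      rw [Matrix.zero_mulVec]
      exact this
    -- If the kernel did not shrink, `ker X` would be invariant under all `(A i)ᴴ`, hence trivial or
    -- everything; both are excluded.
    have hlt : LinearMap.ker (X + cpm A X).mulVecLin < LinearMap.ker X.mulVecLin := by
      refine lt_of_le_of_ne hle fun heq => ?_
      rcases hA.conjTranspose.eq_bot_or_eq_top (LinearMap.ker X.mulVecLin) (fun i v hv => by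
        rw [← heq] at hv
        simp only [LinearMap.mem_ker, Matrix.mulVecLin_apply] at hv ⊢
        exact (cpm_mulVec_eq_zero_iff A hX v).1
          ((mulVec_add_eq_zero_iff hX (cpm_posSemidef A hX) v).1 hv).2 i) with h | h
      · refine hker fun v hv => ?_
        have : v ∈ LinearMap.ker X.mulVecLin := by simpa using hv
        rw [h] at this
        simpa using this
      · exact hX' h
    obtain ⟨k, hk⟩ := ih _ (hm ▸ Submodule.finrank_lt_finrank_of_lt hlt) hY (fun h0 => by
      rw [h0] at hlt
      refine hX' (top_le_iff.1 (le_trans ?_ hlt.le))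
      intro v _
      simp) rfl
    refine ⟨k + 1, ?_⟩
    rw [pow_succ, Module.End.mul_apply, LinearMap.add_apply, Module.End.one_apply]
    exact hk

/-- A nonzero irreducible completely positive map has a positive definite eigenvector with positive
eigenvalue. -/
theorem IsIrreducible.exists_posDef_eigenvector {A : Tensor ι n} (hA : IsIrreducible A)
    (hA0 : ∃ i, A i ≠ 0) :
    ∃ (r : ℝ) (ρ : Matrix n n ℂ), 0 < r ∧ ρ.PosDef ∧ cpm A ρ = (r : ℂ) • ρ := by
  have hne0 : Nonempty n := by
    by_contra h
    rw [not_nonempty_iff] at h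
    obtain ⟨i, hi⟩ := hA0
    exact hi (Subsingleton.elim _ _)
  have hcont : Continuous (cpm A) := (cpm A).continuous_of_finiteDimensional
  let K : Set (Matrix n n ℂ) := {C | (C * Cᴴ).trace = 1}
  have hK : IsCompact K := isCompact_trace_mul_conjTranspose_eq_one
  let f : Matrix n n ℂ → ℝ := fun C => (cpm A (C * Cᴴ)).trace.re
  have hf : Continuous f := by
    refine Complex.continuous_re.comp (Continuous.matrix_trace (hcont.comp ?_))
    fun_prop
  obtain ⟨b, hb⟩ := (hK.image hf).bddAbove
  -- Collatz-Wielandt principle: the eigenvalue is the largest `t` with `E(X) ≥ t X` for some `X` of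
  -- trace one. Writing `X = C Cᴴ` builds positivity into the parametrization.
  let T : Set (ℝ × Matrix n n ℂ) := {q | 0 ≤ q.1 ∧ q.2 ∈ K ∧
    (cpm A (q.2 * q.2ᴴ) - (q.1 : ℂ) • (q.2 * q.2ᴴ)).PosSemidef}
  have hTb : ∀ q ∈ T, q.1 ≤ b := by
    rintro ⟨t, C⟩ ⟨h0, h1, h2⟩
    refine le_trans ?_ (hb ⟨C, h1, rfl⟩)
    have h3 := h2.trace_nonneg
    rw [Matrix.trace_sub, Matrix.trace_smul, show (C * Cᴴ).trace = 1 from h1] at h3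
    have h4 := (Complex.le_def.1 h3).1
    simp at h4
    exact h4
  have hT : IsCompact T := by
    refine IsCompact.of_isClosed_subset ((isCompact_Icc (a := (0 : ℝ)) (b := b)).prod hK) ?_ ?_
    · refine IsClosed.inter (isClosed_le continuous_const continuous_fst) (IsClosed.inter ?_ ?_)
      · exact hK.isClosed.preimage continuous_snd
      · refine isClosed_posSemidef.preimage ?_
        refine Continuous.sub (hcont.comp (by fun_prop)) ?_
        refine Continuous.smul (Complex.continuous_ofReal.comp continuous_fst) (by fun_prop)
    · intro q hq
      exact ⟨⟨hq.1, hTb q hq⟩, hq.2.1⟩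
  have hscale : ∀ Y : Matrix n n ℂ, Y.PosSemidef → Y ≠ 0 → ∀ t : ℝ, 0 ≤ t →
      (cpm A Y - (t : ℂ) • Y).PosSemidef → ∃ C, (t, C) ∈ T := by
    intro Y hY hY0 t ht hYt
    obtain ⟨B, rfl⟩ : ∃ B : Matrix n n ℂ, Y = B * Bᴴ := by
      open scoped MatrixOrder in
      obtain ⟨B, hB⟩ := CStarAlgebra.nonneg_iff_eq_star_mul_self.mp hY.nonneg
      exact ⟨Bᴴ, by simpa [Matrix.star_eq_conjTranspose] using hB⟩
    have htr : 0 < (B * Bᴴ).trace :=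
      lt_of_le_of_ne hY.trace_nonneg fun h => hY0 (hY.trace_eq_zero_iff.1 h.symm)
    obtain ⟨x, hx, hxB⟩ : ∃ x : ℝ, 0 < x ∧ (B * Bᴴ).trace = x := by
      refine ⟨(B * Bᴴ).trace.re, (Complex.lt_def.1 htr).1, ?_⟩
      refine Complex.ext rfl ?_
      simpa using (Complex.lt_def.1 htr).2.symm
    let c : ℝ := (Real.sqrt x)⁻¹
    have hc : ((c : ℂ) • B) * ((c : ℂ) • B)ᴴ = ((x⁻¹ : ℝ) : ℂ) • (B * Bᴴ) := by
      rw [Matrix.conjTranspose_smul, Matrix.smul_mul, Matrix.mul_smul, smul_smul]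
      congr 1
      have : c * c = x⁻¹ := by
        simp only [c]
        rw [← mul_inv, Real.mul_self_sqrt hx.le]
      rw [← this]
      simp
    refine ⟨(c : ℂ) • B, ht, ?_, ?_⟩
    · change (((c : ℂ) • B) * ((c : ℂ) • B)ᴴ).trace = 1
      rw [hc, Matrix.trace_smul, hxB, smul_eq_mul, ← Complex.ofReal_mul, inv_mul_cancel₀ hx.ne',
        Complex.ofReal_one]
    · change (cpm A (((c : ℂ) • B) * ((c : ℂ) • B)ᴴ) -
        (t : ℂ) • (((c : ℂ) • B) * ((c : ℂ) • B)ᴴ)).PosSemidef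
      rw [hc, map_smul, smul_comm, ← smul_sub]
      exact hYt.smul (by exact_mod_cast (inv_nonneg.2 hx.le))
  have hTne : T.Nonempty := by
    obtain ⟨C, hC⟩ := hscale 1 Matrix.PosSemidef.one one_ne_zero 0 le_rfl
      (by simpa using cpm_posSemidef A Matrix.PosSemidef.one)
    exact ⟨_, hC⟩
  obtain ⟨⟨r, C⟩, ⟨hr, hCK, hCr⟩, hmax⟩ := hT.exists_isMaxOn hTne continuous_fst.continuousOn
  have hmax' : ∀ t C', (t, C') ∈ T → t ≤ r := fun t C' h => hmax h
  simp only at hr hCK hCr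
  set X := C * Cᴴ with hXdef
  have hX : X.PosSemidef := Matrix.posSemidef_self_mul_conjTranspose C
  have hX0 : X ≠ 0 := by
    intro h
    have : X.trace = 1 := hCK
    rw [h] at this
    simp at this
  have heig : cpm A X = (r : ℂ) • X := by
    -- If `E(X) - r X` were nonzero, a power of `1 + E` would make it positive definite, giving
    -- `E(Y) ≥ (r + ε) Y` and contradicting maximality of `r`.
    by_contra hne
    obtain ⟨k, hk⟩ := hA.exists_pow_posDef hCr (sub_ne_zero.2 hne)
    set Y := ((1 + cpm A) ^ k) X with hYdef
    have hY : Y.PosSemidef := one_add_cpm_pow_posSemidef A hX k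
    have hcomm : cpm A Y = ((1 + cpm A) ^ k) (cpm A X) := by
      have : Commute (cpm A) ((1 + cpm A) ^ k) :=
        Commute.pow_right ((Commute.one_right _).add_right (Commute.refl _)) k
      rw [hYdef, ← Module.End.mul_apply, this.eq, Module.End.mul_apply]
    rw [map_sub, map_smul, ← hcomm, ← hYdef] at hk
    obtain ⟨ε, hε, h1⟩ := exists_pos_posSemidef_sub hk hY.1
    have hY0 : Y ≠ 0 := by
      intro h
      rw [h, map_zero, smul_zero, sub_zero] at hk
      obtain ⟨i⟩ := hne0
      exact lt_irrefl _ (hk.diag_pos (i := i))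
    obtain ⟨C', hC'⟩ := hscale Y hY hY0 (r + ε) (by linarith) (by
      rw [sub_sub, ← add_smul] at h1
      exact_mod_cast h1)
    linarith [hmax' _ _ hC']
  -- As `X` is an eigenvector, `(1 + E)^k X` is a positive multiple of `X`, so positivity
  -- improvement makes `X` itself positive definite.
  obtain ⟨k, hk⟩ := hA.exists_pow_posDef hX hX0
  have hpow : ((1 + cpm A) ^ k) X = ((1 + r : ℝ) ^ k : ℂ) • X := by
    clear hk
    induction k with
    | zero => simp
    | succ k ih =>
      rw [pow_succ', Module.End.mul_apply, ih, LinearMap.add_apply, Module.End.one_apply, map_smul,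
        heig, pow_succ]
      push_cast
      module
  have hXpd : X.PosDef := by
    rw [hpow] at hk
    have hpos : (0 : ℝ) < (1 + r) ^ k := by positivity
    have := hk.smul (show (0 : ℂ) < ((((1 + r) ^ k)⁻¹ : ℝ) : ℂ) by
      exact_mod_cast inv_pos.2 hpos)
    rw [smul_smul] at this
    convert this using 1
    rw [show ((((1 + r) ^ k)⁻¹ : ℝ) : ℂ) * ((1 + r : ℝ) : ℂ) ^ k = 1 by
      rw [← Complex.ofReal_pow, ← Complex.ofReal_mul, inv_mul_cancel₀ hpos.ne',
        Complex.ofReal_one], one_smul]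
  refine ⟨r, X, lt_of_le_of_ne hr fun h0 => ?_, hXpd, heig⟩
  rw [← h0] at heig
  obtain ⟨i, hi⟩ := hA0
  refine hi (Matrix.conjTranspose_eq_zero.1 (Matrix.ext_of_mulVec_single fun j => ?_))
  have h1 := (cpm_mulVec_eq_zero_iff A hX (Pi.single j 1)).1 (by
    rw [heig, Complex.ofReal_zero, zero_smul, Matrix.zero_mulVec]) i
  have h2 := (hX.dotProduct_mulVec_zero_iff _).2 h1
  by_contra hne
  have h3 := hXpd.dotProduct_mulVec_pos (x := (A i)ᴴ *ᵥ Pi.single j 1) (by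
    rwa [Matrix.zero_mulVec] at hne)
  exact h3.ne' h2

end PerronFrobenius

/-! ### Weighted Hilbert-Schmidt norms -/

section WeightedTrace

variable {n m : Type} [Fintype n] [Fintype m]

open scoped MatrixOrder in
theorem exists_eq_mul_conjTranspose {Y : Matrix n n ℂ} (hY : Y.PosSemidef) :
    ∃ B : Matrix n n ℂ, Y = B * Bᴴ := by
  classical
  obtain ⟨B, hB⟩ := CStarAlgebra.nonneg_iff_eq_star_mul_self.mp hY.nonneg
  exact ⟨Bᴴ, by simpa [Matrix.star_eq_conjTranspose] using hB⟩

theorem eq_zero_of_mul_mul_conjTranspose {ρ : Matrix m m ℂ} (hρ : ρ.PosDef) {Y : Matrix n m ℂ}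
    (h : Y * ρ * Yᴴ = 0) : Y = 0 := by
  classical
  refine Matrix.conjTranspose_eq_zero.1 (Matrix.ext_of_mulVec_single fun j => ?_)
  rw [Matrix.zero_mulVec]
  by_contra hne
  refine (hρ.dotProduct_mulVec_pos hne).ne' ?_
  rw [Matrix.star_mulVec, Matrix.conjTranspose_conjTranspose, ← Matrix.dotProduct_mulVec,
    Matrix.mulVec_mulVec, Matrix.mulVec_mulVec, h]
  simp

/-- The trace is the squared Hilbert-Schmidt norm of `σ^(1/2) Y ρ^(1/2)`; this weighted norm
measures failure of intertwining below. -/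
theorem trace_weighted_nonneg {σ : Matrix n n ℂ} {ρ : Matrix m m ℂ} (hσ : σ.PosDef)
    (hρ : ρ.PosDef) (Y : Matrix n m ℂ) : 0 ≤ (σ * (Y * ρ * Yᴴ)).trace := by
  obtain ⟨L, hL⟩ := exists_eq_mul_conjTranspose (hρ.posSemidef.mul_mul_conjTranspose_same Y)
  rw [hL, ← Matrix.mul_assoc, Matrix.trace_mul_comm, ← Matrix.mul_assoc]
  exact (hσ.posSemidef.conjTranspose_mul_mul_same L).trace_nonneg

theorem trace_weighted_eq_zero {σ : Matrix n n ℂ} {ρ : Matrix m m ℂ} (hσ : σ.PosDef)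
    (hρ : ρ.PosDef) {Y : Matrix n m ℂ} (h : (σ * (Y * ρ * Yᴴ)).trace = 0) : Y = 0 := by
  obtain ⟨L, hL⟩ := exists_eq_mul_conjTranspose (hρ.posSemidef.mul_mul_conjTranspose_same Y)
  rw [hL, ← Matrix.mul_assoc, Matrix.trace_mul_comm, ← Matrix.mul_assoc] at h
  have h1 := (hσ.posSemidef.conjTranspose_mul_mul_same L).trace_eq_zero_iff.1 h
  have h2 : Lᴴ = 0 := eq_zero_of_mul_mul_conjTranspose hσ (by simpa using h1)
  rw [h2, Matrix.mul_zero] at hL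
  exact eq_zero_of_mul_mul_conjTranspose hρ hL

theorem trace_mul_pos {σ ρ : Matrix n n ℂ} [Nonempty n] (hσ : σ.PosDef) (hρ : ρ.PosDef) :
    0 < (σ * ρ).trace := by
  classical
  have h := trace_weighted_nonneg hσ hρ 1
  have h' : (σ * ρ).trace ≠ 0 := fun h0 =>
    one_ne_zero (trace_weighted_eq_zero hσ hρ (Y := (1 : Matrix n n ℂ)) (by simpa using h0))
  exact lt_of_le_of_ne (by simpa using h) h'.symm

end WeightedTrace

/-! ### Mixed transfer maps and intertwiners -/

section Intertwiner

variable {ι n m : Type} [Fintype ι] [Fintype n] [DecidableEq n] [Fintype m] [DecidableEq m]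

/-- The eigenvalues of the mixed transfer map `X ↦ ∑ i, A i * X * (B i)ᴴ` are bounded by the
geometric mean of the spectral radii, and an eigenvalue attaining the bound comes with an
intertwiner. -/
theorem mixed_eigenvalue_bound {A : Tensor ι n} {B : Tensor ι m} {σ : Matrix n n ℂ}
    {ρ : Matrix m m ℂ} {a b : ℝ} (hb : 0 < b) (hσ : σ.PosDef) (hρ : ρ.PosDef)
    (hAσ : cpm (fun i => (A i)ᴴ) σ = (a : ℂ) • σ) (hBρ : cpm B ρ = (b : ℂ) • ρ)
    {X : Matrix n m ℂ} (hX0 : X ≠ 0) {z : ℂ} (hX : ∑ i, A i * X * (B i)ᴴ = z • X) :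
    ‖z‖ ^ 2 ≤ a * b ∧
      (‖z‖ ^ 2 = a * b → ∃ Y : Matrix n m ℂ, Y ≠ 0 ∧ ∀ i, A i * Y = (z / b) • (Y * B i)) := by
  have hdet : IsUnit ρ.det := (Matrix.isUnit_iff_isUnit_det _).1 hρ.isUnit
  obtain ⟨Y, rfl⟩ : ∃ Y, X = Y * ρ := ⟨X * ρ⁻¹, by
    rw [Matrix.mul_assoc, Matrix.nonsing_inv_mul _ hdet, Matrix.mul_one]⟩
  have hY0 : Y ≠ 0 := by rintro rfl; simp at hX0
  set T := (σ * (Y * ρ * Yᴴ)).trace with hT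
  have hTpos : 0 < T :=
    lt_of_le_of_ne (trace_weighted_nonneg hσ hρ Y) fun h =>
      hY0 (trace_weighted_eq_zero hσ hρ h.symm)
  set c : ℂ := z / b with hc
  -- The defect of `Y` as an intertwiner. Its total weighted norm is `(a - ‖z‖² / b) * T`;
  -- nonnegativity is the bound, and vanishing is the intertwining relation.
  let Q : ι → Matrix n m ℂ := fun i => A i * Y - c • (Y * B i)
  have h1 : ∑ i, (σ * (A i * Y * ρ * Yᴴ * (A i)ᴴ)).trace = a * T := by
    have : ∀ i, (σ * (A i * Y * ρ * Yᴴ * (A i)ᴴ)).trace =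
        (((A i)ᴴ * σ * (A i)ᴴᴴ) * (Y * ρ * Yᴴ)).trace := by
      intro i
      rw [Matrix.conjTranspose_conjTranspose, ← Matrix.mul_assoc, Matrix.trace_mul_comm]
      simp only [Matrix.mul_assoc]
    simp only [this]
    rw [← Matrix.trace_sum, ← Matrix.sum_mul, ← cpm_apply (fun i => (A i)ᴴ), hAσ, Matrix.smul_mul,
      Matrix.trace_smul, smul_eq_mul]
  have h2 : ∑ i, (σ * (A i * Y * ρ * (B i)ᴴ * Yᴴ)).trace = z * T := by
    rw [← Matrix.trace_sum, ← Matrix.mul_sum, ← Matrix.sum_mul]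
    simp only [Matrix.mul_assoc] at hX ⊢
    rw [hX, Matrix.smul_mul, Matrix.mul_smul, Matrix.trace_smul, smul_eq_mul, hT]
  have h3 : ∑ i, (σ * (Y * B i * ρ * Yᴴ * (A i)ᴴ)).trace = star z * T := by
    have hX' := congrArg Matrix.conjTranspose hX
    simp only [Matrix.conjTranspose_sum, Matrix.conjTranspose_mul, hρ.1.eq,
      Matrix.conjTranspose_conjTranspose, Matrix.conjTranspose_smul] at hX'
    rw [← Matrix.trace_sum, ← Matrix.mul_sum]
    simp only [Matrix.mul_assoc] at hX' ⊢
    rw [← Matrix.mul_sum, hX', Matrix.mul_smul, Matrix.mul_smul, Matrix.trace_smul, smul_eq_mul,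
      hT]
    simp only [Matrix.mul_assoc]
  have h4 : ∑ i, (σ * (Y * B i * ρ * (B i)ᴴ * Yᴴ)).trace = b * T := by
    rw [← Matrix.trace_sum, ← Matrix.mul_sum, ← Matrix.sum_mul]
    simp only [Matrix.mul_assoc]
    rw [← Matrix.mul_sum]
    simp only [cpm_apply, Matrix.mul_assoc] at hBρ
    rw [hBρ, hT]
    simp [Matrix.mul_assoc]
  have hQ : ∑ i, (σ * (Q i * ρ * (Q i)ᴴ)).trace = ((a - ‖z‖ ^ 2 / b : ℝ) : ℂ) * T := by
    have h5 : ∀ i, (σ * (Q i * ρ * (Q i)ᴴ)).trace = (σ * (A i * Y * ρ * Yᴴ * (A i)ᴴ)).trace -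
        star c * (σ * (A i * Y * ρ * (B i)ᴴ * Yᴴ)).trace -
        c * (σ * (Y * B i * ρ * Yᴴ * (A i)ᴴ)).trace +
        c * star c * (σ * (Y * B i * ρ * (B i)ᴴ * Yᴴ)).trace := by
      intro i
      simp only [Q, Matrix.conjTranspose_sub, Matrix.conjTranspose_mul, Matrix.conjTranspose_smul,
        Matrix.sub_mul, Matrix.mul_sub, Matrix.smul_mul, Matrix.mul_smul, Matrix.trace_sub,
        Matrix.trace_smul, smul_eq_mul, Matrix.mul_assoc]
      ring
    simp only [h5]
    rw [Finset.sum_add_distrib, Finset.sum_sub_distrib, Finset.sum_sub_distrib, ← Finset.mul_sum,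
      ← Finset.mul_sum, ← Finset.mul_sum, h1, h2, h3, h4]
    have hb' : (b : ℂ) ≠ 0 := by exact_mod_cast hb.ne'
    have hz : z * star z = ((‖z‖ ^ 2 : ℝ) : ℂ) := by
      rw [Complex.star_def, Complex.mul_conj, Complex.normSq_eq_norm_sq]
    have hcs : star c = star z / b := by simp [hc]
    rw [hcs, hc]
    push_cast at hz ⊢
    rw [← hz]
    field_simp
    ring
  have hQnonneg : ∀ i, 0 ≤ (σ * (Q i * ρ * (Q i)ᴴ)).trace := fun i =>
    trace_weighted_nonneg hσ hρ _
  constructor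
  · have h6 : 0 ≤ ((a - ‖z‖ ^ 2 / b : ℝ) : ℂ) * T := hQ ▸ Finset.sum_nonneg fun i _ => hQnonneg i
    have h7 := (Complex.le_def.1 h6).1
    rw [Complex.re_ofReal_mul, Complex.zero_re] at h7
    have h8 : 0 ≤ a - ‖z‖ ^ 2 / b := nonneg_of_mul_nonneg_left h7 (Complex.lt_def.1 hTpos).1
    rwa [sub_nonneg, div_le_iff₀ hb] at h8
  · intro heq
    refine ⟨Y, hY0, fun i => ?_⟩
    rw [heq, mul_div_cancel_right₀ _ hb.ne', sub_self, Complex.ofReal_zero, zero_mul,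
      Finset.sum_eq_zero_iff_of_nonneg fun i _ => hQnonneg i] at hQ
    exact sub_eq_zero.1 (trace_weighted_eq_zero hσ hρ (hQ i (Finset.mem_univ i)))

/-- Perron-Frobenius data of a nonzero irreducible tensor: right and left positive definite
eigenvectors with the same positive eigenvalue. -/
theorem IsIrreducible.exists_perron {A : Tensor ι n} (hA : IsIrreducible A)
    (hA0 : ∃ i, A i ≠ 0) :
    ∃ (r : ℝ) (σ ρ : Matrix n n ℂ), 0 < r ∧ σ.PosDef ∧ ρ.PosDef ∧ cpm A ρ = (r : ℂ) • ρ ∧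
      cpm (fun i => (A i)ᴴ) σ = (r : ℂ) • σ := by
  have hne : Nonempty n := by
    by_contra h
    rw [not_nonempty_iff] at h
    obtain ⟨i, hi⟩ := hA0
    exact hi (Subsingleton.elim _ _)
  obtain ⟨r, ρ, hr, hρ, hAρ⟩ := hA.exists_posDef_eigenvector hA0
  obtain ⟨s, σ, hs, hσ, hAσ⟩ := hA.conjTranspose.exists_posDef_eigenvector
    (by obtain ⟨i, hi⟩ := hA0; exact ⟨i, by simpa using hi⟩)
  have hpos := trace_mul_pos hσ hρ
  -- Pairing the two eigenvectors through the adjoint map forces `r = s`, because `tr (σ ρ) > 0`.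
  have h1 : (σ * cpm A ρ).trace = (cpm (fun i => (A i)ᴴ) σ * ρ).trace := by
    simp only [cpm_apply, Matrix.mul_sum, Matrix.sum_mul, Matrix.trace_sum]
    refine Finset.sum_congr rfl fun i _ => ?_
    rw [Matrix.conjTranspose_conjTranspose, ← Matrix.mul_assoc, Matrix.trace_mul_comm]
    simp only [Matrix.mul_assoc]
  rw [hAρ, hAσ, Matrix.mul_smul, Matrix.smul_mul, Matrix.trace_smul, Matrix.trace_smul] at h1
  have h2 : (r : ℂ) = s := mul_right_cancel₀ hpos.ne' h1
  exact ⟨r, σ, ρ, hr, hσ, hρ, hAρ, h2 ▸ hAσ⟩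

end Intertwiner

/-! ### Tensors spanned by positive semidefinite combinations -/

section PosGenerated

variable {ι n m : Type} [Fintype ι] [Fintype n] [Fintype m]

/-- The linear combinations of the tensor with coefficients in `S` are positive semidefinite and
span all the matrices of the tensor. -/
def PosGenerated (S : Set (ι → ℂ)) (A : Tensor ι n) : Prop :=
  (∀ c ∈ S, (∑ i, c i • A i).PosSemidef) ∧
    ∀ i, A i ∈ Submodule.span ℂ ((fun c : ι → ℂ => ∑ i, c i • A i) '' S)

omit [Fintype n] in
-- This is how positivity is exploited: a linear identity has to be checked only on the combinations
-- from `S`, which are Hermitian and positive.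
theorem PosGenerated.map_eq_zero {S : Set (ι → ℂ)} {A : Tensor ι n} (hA : PosGenerated S A)
    {E : Type*} [AddCommGroup E] [Module ℂ E] (L : Matrix n n ℂ →ₗ[ℂ] E)
    (h : ∀ c ∈ S, L (∑ i, c i • A i) = 0) (i : ι) : L (A i) = 0 := by
  have h1 : Submodule.span ℂ ((fun c : ι → ℂ => ∑ i, c i • A i) '' S) ≤ LinearMap.ker L := by
    rw [Submodule.span_le]
    rintro _ ⟨c, hc, rfl⟩
    exact h c hc
  exact h1 (hA.2 i)

/-- Compression preserves positivity and is linear, so the same set `S` serves for every block; this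
shared `S` is what makes different blocks comparable. -/
theorem PosGenerated.compress {S : Set (ι → ℂ)} {A : Tensor ι n} (hA : PosGenerated S A)
    (W : Matrix n m ℂ) : PosGenerated S fun i => Wᴴ * A i * W := by
  have h : ∀ c : ι → ℂ, ∑ i, c i • (Wᴴ * A i * W) = Wᴴ * (∑ i, c i • A i) * W := by
    intro c
    simp [Matrix.mul_sum, Matrix.sum_mul]
  refine ⟨fun c hc => ?_, fun i => ?_⟩
  · rw [h]
    exact (hA.1 c hc).conjTranspose_mul_mul_same W
  · let L : Matrix n n ℂ →ₗ[ℂ] Matrix m m ℂ :=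
      { toFun := fun X => Wᴴ * X * W
        map_add' := fun X Y => by rw [Matrix.mul_add, Matrix.add_mul]
        map_smul' := fun c X => by simp }
    have h1 := Submodule.mem_map_of_mem (f := L) (hA.2 i)
    rw [Submodule.map_span, ← Set.image_comp] at h1
    have h2 : (fun c : ι → ℂ => ∑ i, c i • (Wᴴ * A i * W)) =
        L ∘ fun c : ι → ℂ => ∑ i, c i • A i := funext h
    rw [h2]
    exact h1

/-- Invariant projectors of a positively generated tensor are reducing. -/
theorem PosGenerated.commute {S : Set (ι → ℂ)} {A : Tensor ι n} (hA : PosGenerated S A)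
    {P : Matrix n n ℂ} (hP : P.IsHermitian) (h : ∀ i, A i * P = P * A i * P) (i : ι) :
    A i * P = P * A i := by
  let L : Matrix n n ℂ →ₗ[ℂ] Matrix n n ℂ := LinearMap.mulRight ℂ P - LinearMap.mulLeft ℂ P
  refine sub_eq_zero.1 (hA.map_eq_zero L (fun c hc => ?_) i)
  have h1 : (∑ i, c i • A i) * P = P * (∑ i, c i • A i) * P := by
    simp only [Matrix.sum_mul, Matrix.mul_sum, Matrix.smul_mul, Matrix.mul_smul]
    exact Finset.sum_congr rfl fun i _ => by rw [← h]
  have h2 := congrArg Matrix.conjTranspose h1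
  simp only [Matrix.conjTranspose_mul, hP.eq, (hA.1 c hc).1.eq] at h2
  rw [← Matrix.mul_assoc] at h2
  exact sub_eq_zero.2 (h1.trans h2.symm)

omit [Fintype ι] in
-- The common kernel of the matrices is an invariant subspace, and it contains the range of `Y`.
theorem IsIrreducible.eq_zero_of_mul_eq_zero [DecidableEq n] {A : Tensor ι n}
    (hA : IsIrreducible A) {Y : Matrix n m ℂ} (hY : Y ≠ 0) (h : ∀ i, A i * Y = 0) (i : ι) :
    A i = 0 := by
  classical
  let p : Submodule ℂ (n → ℂ) := ⨅ i, LinearMap.ker (A i).mulVecLin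
  have hp : ∀ v, v ∈ p ↔ ∀ i, A i *ᵥ v = 0 := by intro v; simp [p]
  rcases hA.eq_bot_or_eq_top p (fun i v hv => by
    rw [(hp v).1 hv i]; exact Submodule.zero_mem _) with h1 | h1
  · refine absurd (Matrix.ext_of_mulVec_single fun j => ?_) hY
    have : Y *ᵥ Pi.single j 1 ∈ p := by
      rw [hp]
      intro i
      rw [Matrix.mulVec_mulVec, h, Matrix.zero_mulVec]
    rw [h1, Submodule.mem_bot] at this
    rw [this, Matrix.zero_mulVec]
  · refine Matrix.ext_of_mulVec_single fun j => ?_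
    rw [Matrix.zero_mulVec]
    exact (hp _).1 (h1 ▸ Submodule.mem_top) i

omit [Fintype ι] in
/-- A matrix commuting with an irreducible tensor is scalar. -/
theorem IsIrreducible.eq_smul_one_of_commute [DecidableEq n] [Nonempty n] {A : Tensor ι n}
    (hA : IsIrreducible A) {H : Matrix n n ℂ} (h : ∀ i, A i * H = H * A i) :
    ∃ c : ℂ, H = c • (1 : Matrix n n ℂ) := by
  let f : Module.End ℂ (n → ℂ) := Matrix.toLin' H
  obtain ⟨c, hc⟩ := Module.End.exists_eigenvalue f
  refine ⟨c, ?_⟩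
  have hp : ∀ v, v ∈ f.eigenspace c ↔ H *ᵥ v = c • v := by
    intro v; rw [Module.End.mem_eigenspace_iff]; rfl
  rcases hA.eq_bot_or_eq_top (f.eigenspace c) (fun i v hv => by
    rw [hp] at hv ⊢
    rw [Matrix.mulVec_mulVec, ← h, ← Matrix.mulVec_mulVec, hv, Matrix.mulVec_smul]) with h1 | h1
  · exact absurd h1 hc
  · refine Matrix.ext_of_mulVec_single fun j => ?_
    rw [(hp _).1 (h1 ▸ Submodule.mem_top), Matrix.smul_mulVec, Matrix.one_mulVec]

/-- An intertwiner up to a factor between positively generated irreducible tensors can be taken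
unitary, and the factor is positive. -/
theorem PosGenerated.exists_unitary [DecidableEq n] [DecidableEq m] {S : Set (ι → ℂ)}
    {A : Tensor ι n} {B : Tensor ι m} (hA : PosGenerated S A) (hB : PosGenerated S B)
    (hAi : IsIrreducible A) (hBi : IsIrreducible B) (hA0 : ∃ i, A i ≠ 0)
    {Y : Matrix n m ℂ} (hY : Y ≠ 0) {z : ℂ} (h : ∀ i, A i * Y = z • (Y * B i)) :
    ∃ t : ℝ, 0 < t ∧ z = t ∧
      ∃ T : Matrix n m ℂ, Tᴴ * T = 1 ∧ T * Tᴴ = 1 ∧ ∀ i, A i * T = z • (T * B i) := by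
  have hcomb : ∀ c : ι → ℂ, (∑ i, c i • A i) * Y = z • (Y * ∑ i, c i • B i) := by
    intro c
    simp only [Matrix.sum_mul, Matrix.mul_sum, Matrix.smul_mul, Matrix.mul_smul, h,
      Finset.smul_sum]
    exact Finset.sum_congr rfl fun i _ => smul_comm _ _ _
  have hz0 : z ≠ 0 := by
    rintro rfl
    obtain ⟨i, hi⟩ := hA0
    exact hi (hAi.eq_zero_of_mul_eq_zero hY (fun i => by rw [h, zero_smul]) i)
  -- For positive combinations `H`, `K` with equal coefficients, `tr (Yᴴ H Y) = z * tr (Y K Yᴴ)`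
  -- with both traces nonnegative. If `z` is not nonnegative, both vanish for all coefficients in
  -- `S`, whence `H Y = 0` always and the tensor is zero.
  have hz : 0 ≤ z := by
    by_contra hz
    obtain ⟨i, hi⟩ := hA0
    refine hi (hAi.eq_zero_of_mul_eq_zero hY (fun i => ?_) i)
    let L : Matrix n n ℂ →ₗ[ℂ] Matrix n m ℂ :=
      { toFun := fun X => X * Y
        map_add' := fun X Z => Matrix.add_mul X Z Y
        map_smul' := fun c X => Matrix.smul_mul c X Y }
    refine hA.map_eq_zero L (fun c hc => ?_) i
    change (∑ i, c i • A i) * Y = 0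
    have h1 := (hA.1 c hc).conjTranspose_mul_mul_same Y
    have h2 := ((hB.1 c hc).mul_mul_conjTranspose_same Y).trace_nonneg
    have h3 : (Yᴴ * (∑ i, c i • A i) * Y).trace = z * (Y * (∑ i, c i • B i) * Yᴴ).trace := by
      rw [Matrix.mul_assoc, hcomb, Matrix.mul_smul, Matrix.trace_smul, smul_eq_mul,
        Matrix.trace_mul_comm]
    have h4 := h1.trace_nonneg
    rw [h3] at h4
    have h5 : (Y * (∑ i, c i • B i) * Yᴴ).trace = 0 := by
      by_contra hne
      refine hz ?_
      have h6 : z = (z * (Y * (∑ i, c i • B i) * Yᴴ).trace) *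
          ((Y * (∑ i, c i • B i) * Yᴴ).trace)⁻¹ := by
        rw [mul_assoc, mul_inv_cancel₀ hne, mul_one]
      rw [h6]
      refine mul_nonneg h4 ?_
      exact inv_nonneg_of_nonneg h2
    rw [h5, mul_zero] at h3
    have h6 := h1.trace_eq_zero_iff.1 h3
    refine Matrix.ext_of_mulVec_single fun j => ?_
    rw [Matrix.zero_mulVec, ← Matrix.mulVec_mulVec, ← (hA.1 c hc).dotProduct_mulVec_zero_iff,
      Matrix.star_mulVec, ← Matrix.dotProduct_mulVec, Matrix.mulVec_mulVec, Matrix.mulVec_mulVec,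
      h6]
    simp
  obtain ⟨t, ht, rfl⟩ : ∃ t : ℝ, 0 < t ∧ z = t := by
    have hre := Complex.le_def.1 hz
    have hzz : z = (z.re : ℂ) := Complex.ext rfl (by simpa using hre.2.symm)
    refine ⟨z.re, lt_of_le_of_ne hre.1 fun h0 => hz0 ?_, hzz⟩
    rw [hzz, ← h0]; simp
  refine ⟨t, ht, rfl, ?_⟩
  have hcomb' : ∀ c ∈ S, Yᴴ * (∑ i, c i • A i) = (t : ℂ) • ((∑ i, c i • B i) * Yᴴ) := by
    intro c hc
    have := congrArg Matrix.conjTranspose (hcomb c)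
    simpa [Matrix.conjTranspose_mul, Matrix.conjTranspose_smul, (hA.1 c hc).1.eq,
      (hB.1 c hc).1.eq] using this
  have hne_m : Nonempty m := by
    by_contra hm
    rw [not_nonempty_iff] at hm
    exact hY (Matrix.ext fun _ j => (hm.false j).elim)
  have hne_n : Nonempty n := by
    by_contra hn
    rw [not_nonempty_iff] at hn
    exact hY (Matrix.ext fun j _ => (hn.false j).elim)
  -- Combining the intertwining relation with its adjoint shows that `Yᴴ Y` commutes with the
  -- tensor; Schur's lemma makes it scalar. The same holds for `Y Yᴴ`, so `Y` is a multiple of a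
  -- unitary.
  obtain ⟨x, hx⟩ := hBi.eq_smul_one_of_commute (H := Yᴴ * Y) (fun i => by
    refine sub_eq_zero.1 (hB.map_eq_zero
      (LinearMap.mulRight ℂ (Yᴴ * Y) - LinearMap.mulLeft ℂ (Yᴴ * Y)) (fun c hc => ?_) i)
    refine sub_eq_zero.2 (smul_right_injective _ hz0 ?_)
    change (t : ℂ) • ((∑ i, c i • B i) * (Yᴴ * Y)) = (t : ℂ) • (Yᴴ * Y * (∑ i, c i • B i))
    rw [← Matrix.mul_assoc, ← Matrix.smul_mul, ← hcomb' c hc, Matrix.mul_assoc, Matrix.mul_assoc,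
      hcomb, Matrix.mul_smul])
  obtain ⟨y, hy⟩ := hAi.eq_smul_one_of_commute (H := Y * Yᴴ) (fun i => by
    refine sub_eq_zero.1 (hA.map_eq_zero
      (LinearMap.mulRight ℂ (Y * Yᴴ) - LinearMap.mulLeft ℂ (Y * Yᴴ)) (fun c hc => ?_) i)
    refine sub_eq_zero.2 ?_
    change (∑ i, c i • A i) * (Y * Yᴴ) = Y * Yᴴ * (∑ i, c i • A i)
    rw [← Matrix.mul_assoc, hcomb, Matrix.mul_assoc, hcomb' c hc, Matrix.smul_mul,
      Matrix.mul_smul, Matrix.mul_assoc])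
  have hxy : x = y := by
    have h1 : x • Y = y • Y := by
      calc x • Y = Y * (Yᴴ * Y) := by rw [hx, Matrix.mul_smul, Matrix.mul_one]
        _ = y • Y := by rw [← Matrix.mul_assoc, hy, Matrix.smul_mul, Matrix.one_mul]
    exact smul_left_injective ℂ hY h1
  subst hxy
  have hx0 : 0 < x := by
    obtain ⟨j⟩ := hne_m
    have h1 := (Matrix.posSemidef_conjTranspose_mul_self Y).diag_nonneg (i := j)
    rw [hx] at h1
    refine lt_of_le_of_ne (by simpa using h1) fun h0 => hY ?_
    rw [← h0, zero_smul] at hx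
    exact Matrix.conjTranspose_mul_self_eq_zero.1 hx
  obtain ⟨s, hs, rfl⟩ : ∃ s : ℝ, 0 < s ∧ x = s :=
    ⟨x.re, (Complex.lt_def.1 hx0).1, Complex.ext rfl (by simpa using (Complex.lt_def.1 hx0).2.symm)⟩
  let c : ℝ := (Real.sqrt s)⁻¹
  have hc : (c : ℂ) * c * s = 1 := by
    have : c * c * s = 1 := by
      simp only [c]
      rw [← mul_inv, Real.mul_self_sqrt hs.le, inv_mul_cancel₀ hs.ne']
    exact_mod_cast this
  refine ⟨(c : ℂ) • Y, ?_, ?_, fun i => ?_⟩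
  · rw [Matrix.conjTranspose_smul, Matrix.smul_mul, Matrix.mul_smul, hx, smul_smul, smul_smul]
    rw [Complex.star_def, Complex.conj_ofReal, hc, one_smul]
  · rw [Matrix.conjTranspose_smul, Matrix.smul_mul, Matrix.mul_smul, hy, smul_smul, smul_smul]
    rw [Complex.star_def, Complex.conj_ofReal, hc, one_smul]
  · rw [Matrix.mul_smul, h, Matrix.smul_mul, smul_comm]

end PosGenerated

/-! ### Normalized irreducible blocks -/

section PerronBlock

variable {ι n m : Type} [Fintype ι] [Fintype n] [DecidableEq n] [Fintype m] [DecidableEq m]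

/-- A nonzero irreducible positively generated tensor, scaled to have spectral radius one. -/
structure IsPerronBlock (S : Set (ι → ℂ)) (B : Tensor ι n) : Prop where
  posGenerated : PosGenerated S B
  irreducible : IsIrreducible B
  ne_zero : ∃ i, B i ≠ 0
  perron : ∃ σ ρ : Matrix n n ℂ, σ.PosDef ∧ ρ.PosDef ∧ cpm B ρ = ρ ∧
    cpm (fun i => (B i)ᴴ) σ = σ

omit [Fintype n] [DecidableEq n] in
theorem PosGenerated.smul {S : Set (ι → ℂ)} {A : Tensor ι n} (hA : PosGenerated S A) {s : ℝ}
    (hs : 0 ≤ s) : PosGenerated S fun i => (s : ℂ) • A i := by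
  have h : ∀ c : ι → ℂ, ∑ i, c i • ((s : ℂ) • A i) = (s : ℂ) • ∑ i, c i • A i := by
    intro c
    rw [Finset.smul_sum]
    exact Finset.sum_congr rfl fun i _ => smul_comm _ _ _
  refine ⟨fun c hc => ?_, fun i => ?_⟩
  · rw [h]
    exact (hA.1 c hc).smul (by exact_mod_cast hs)
  · have h1 := Submodule.mem_map_of_mem (f := (s : ℂ) • (LinearMap.id : Matrix n n ℂ →ₗ[ℂ] _))
      (hA.2 i)
    rw [Submodule.map_span, ← Set.image_comp] at h1
    have h2 : (fun c : ι → ℂ => ∑ i, c i • ((s : ℂ) • A i)) =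
        ((s : ℂ) • (LinearMap.id : Matrix n n ℂ →ₗ[ℂ] _)) ∘ fun c : ι → ℂ => ∑ i, c i • A i :=
      funext h
    rw [h2]
    exact h1

omit [Fintype ι] in
theorem IsIrreducible.smul {A : Tensor ι n} (hA : IsIrreducible A) {s : ℂ} (hs : s ≠ 0) :
    IsIrreducible fun i => s • A i := by
  intro P hP hPP h
  refine hA P hP hPP fun i => smul_right_injective _ hs ?_
  simpa [Matrix.smul_mul, Matrix.mul_smul] using h i

theorem cpm_smul (A : Tensor ι n) (s : ℝ) (X : Matrix n n ℂ) :
    cpm (fun i => (s : ℂ) • A i) X = ((s ^ 2 : ℝ) : ℂ) • cpm A X := by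
  simp only [cpm_apply, Finset.smul_sum]
  refine Finset.sum_congr rfl fun i _ => ?_
  rw [Matrix.conjTranspose_smul, Matrix.smul_mul, Matrix.smul_mul, Matrix.mul_smul, smul_smul,
    Complex.star_def, Complex.conj_ofReal, ← Complex.ofReal_mul, sq]

theorem exists_isPerronBlock_smul {S : Set (ι → ℂ)} {A : Tensor ι n} (hA : PosGenerated S A)
    (hAi : IsIrreducible A) (hA0 : ∃ i, A i ≠ 0) :
    ∃ s : ℝ, 0 < s ∧ IsPerronBlock S fun i => (s : ℂ) • A i := by
  obtain ⟨r, σ, ρ, hr, hσ, hρ, h1, h2⟩ := hAi.exists_perron hA0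
  have hs : (Real.sqrt r)⁻¹ ^ 2 * r = 1 := by
    rw [inv_pow, Real.sq_sqrt hr.le, inv_mul_cancel₀ hr.ne']
  have hs' : (0 : ℝ) < (Real.sqrt r)⁻¹ := by positivity
  have hs0 : (((Real.sqrt r)⁻¹ : ℝ) : ℂ) ≠ 0 := by exact_mod_cast hs'.ne'
  refine ⟨(Real.sqrt r)⁻¹, hs', hA.smul hs'.le, hAi.smul hs0, ?_, σ, ρ, hσ, hρ, ?_, ?_⟩
  · obtain ⟨i, hi⟩ := hA0
    exact ⟨i, smul_ne_zero hs0 hi⟩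
  · rw [cpm_smul, h1, smul_smul, ← Complex.ofReal_mul, hs, Complex.ofReal_one, one_smul]
  · have h3 : (fun i => ((((Real.sqrt r)⁻¹ : ℝ) : ℂ) • A i)ᴴ) =
        fun i => (((Real.sqrt r)⁻¹ : ℝ) : ℂ) • (A i)ᴴ := by
      funext i
      rw [Matrix.conjTranspose_smul, Complex.star_def, Complex.conj_ofReal]
    rw [h3, cpm_smul, h2, smul_smul, ← Complex.ofReal_mul, hs, Complex.ofReal_one, one_smul]

/-- At modulus one the bound is attained, and the resulting intertwining factor is `z` itself; being
positive, it equals `1`. -/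
theorem IsPerronBlock.mixed_eigenvalue {S : Set (ι → ℂ)} {A : Tensor ι n} {B : Tensor ι m}
    (hA : IsPerronBlock S A) (hB : IsPerronBlock S B) {X : Matrix n m ℂ} (hX0 : X ≠ 0) {z : ℂ}
    (hX : ∑ i, A i * X * (B i)ᴴ = z • X) :
    ‖z‖ ≤ 1 ∧ (‖z‖ = 1 → z = 1 ∧
      ∃ T : Matrix n m ℂ, Tᴴ * T = 1 ∧ T * Tᴴ = 1 ∧ ∀ i, A i * T = T * B i) := by
  obtain ⟨σ, -, hσ, -, -, h1⟩ := hA.perron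
  obtain ⟨-, ρ, -, hρ, h2, -⟩ := hB.perron
  obtain ⟨h3, h4⟩ := mixed_eigenvalue_bound (a := 1) (b := 1) one_pos hσ hρ
    (by simpa using h1) (by simpa using h2) hX0 hX
  refine ⟨by simpa using h3, fun hz => ?_⟩
  obtain ⟨Y, hY0, hY⟩ := h4 (by simp [hz])
  simp only [Complex.ofReal_one, div_one] at hY
  obtain ⟨t, ht, rfl, T, hT1, hT2, hT⟩ := hA.posGenerated.exists_unitary hB.posGenerated
    hA.irreducible hB.irreducible hA.ne_zero hY0 hY
  have ht1 : t = 1 := by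
    rw [Complex.norm_real, Real.norm_eq_abs, abs_of_pos ht] at hz
    exact hz
  subst ht1
  exact ⟨Complex.ofReal_one, T, hT1, hT2, fun i => by simpa using hT i⟩

theorem IsPerronBlock.nonempty {S : Set (ι → ℂ)} {A : Tensor ι n} (hA : IsPerronBlock S A) :
    Nonempty n := by
  by_contra h
  rw [not_nonempty_iff] at h
  obtain ⟨i, hi⟩ := hA.ne_zero
  exact hi (Subsingleton.elim _ _)

/-- Comparing the block with itself: every eigenvalue of modulus one is `1`, and the Perron
eigenvector shows that `1` occurs. -/
theorem IsPerronBlock.isNormal {S : Set (ι → ℂ)} {A : Tensor ι n} (hA : IsPerronBlock S A) :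
    IsNormal A := by
  have hev : ∀ z : ℂ, (cpm A).HasEigenvalue z → ‖z‖ ≤ 1 ∧ (‖z‖ = 1 → z = 1) := by
    intro z hz
    obtain ⟨X, hX⟩ := hz.exists_hasEigenvector
    have h := hA.mixed_eigenvalue hA hX.2 hX.apply_eq_smul
    exact ⟨h.1, fun h1 => (h.2 h1).1⟩
  refine ⟨hA.irreducible, le_antisymm ?_ ?_, fun z hz => (hev z hz).2⟩
  · refine iSup₂_le fun z hz => ?_
    have := (hev z (Module.End.hasEigenvalue_iff_mem_spectrum.2 hz)).1
    exact_mod_cast this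
  · obtain ⟨σ, ρ, -, hρ, h1, -⟩ := hA.perron
    have h2 : (cpm A).HasEigenvalue 1 := by
      refine Module.End.hasEigenvalue_of_hasEigenvector (x := ρ)
        ⟨Module.End.mem_eigenspace_iff.2 (by rw [h1, one_smul]), fun h0 => ?_⟩
      obtain ⟨i⟩ := hA.nonempty
      have := hρ.diag_pos (i := i)
      rw [h0] at this
      exact lt_irrefl _ this
    refine le_trans ?_ (le_iSup₂ (f := fun (k : ℂ) (_ : k ∈ spectrum ℂ (cpm A)) => (‖k‖₊ : ENNReal))
      1 (Module.End.hasEigenvalue_iff_mem_spectrum.1 h2))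
    simp

end PerronBlock

/-! ### Orthogonal decomposition into irreducible blocks -/

section Decomposition

variable {ι : Type} [Fintype ι]

theorem exists_isometry_of_projector {n : Type} [Fintype n] [DecidableEq n] {P : Matrix n n ℂ}
    (hP : P.IsHermitian) (hPP : P * P = P) :
    ∃ (m : ℕ) (W : Matrix n (Fin m) ℂ), Wᴴ * W = 1 ∧ W * Wᴴ = P := by
  obtain ⟨m, W, hW, h⟩ := exists_isometry (LinearMap.range P.mulVecLin)
  refine ⟨m, W, hW, ?_⟩
  have h1 : W * Wᴴ * P = P := by
    refine Matrix.ext_of_mulVec_single fun j => ?_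
    rw [← Matrix.mulVec_mulVec]
    exact (h _).1 ⟨_, rfl⟩
  have h2 : P * W = W := by
    refine Matrix.ext_of_mulVec_single fun j => ?_
    obtain ⟨v, hv⟩ := (h (W *ᵥ Pi.single j 1)).2 (by
      rw [Matrix.mulVec_mulVec, Matrix.mul_assoc, hW, Matrix.mul_one])
    rw [Matrix.mulVecLin_apply] at hv
    rw [← Matrix.mulVec_mulVec, ← hv, Matrix.mulVec_mulVec, hPP]
  have h3 := congrArg Matrix.conjTranspose h1
  rw [Matrix.conjTranspose_mul, hP.eq, Matrix.conjTranspose_mul, Matrix.conjTranspose_conjTranspose,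
    ← Matrix.mul_assoc, h2] at h3
  exact h3

/-- A positively generated tensor is an orthogonal direct sum of nonzero irreducible blocks and a
zero block. -/
theorem PosGenerated.exists_decomposition {S : Set (ι → ℂ)} {N : ℕ} {A : Tensor ι (Fin N)}
    (hA : PosGenerated S A) :
    ∃ (κ : Type) (_ : Fintype κ) (D : κ → ℕ) (W : (k : κ) → Matrix (Fin N) (Fin (D k)) ℂ),
      (∀ k, (W k)ᴴ * W k = 1) ∧ (∀ k l, k ≠ l → (W k)ᴴ * W l = 0) ∧
      (∀ i, A i = ∑ k, W k * ((W k)ᴴ * A i * W k) * (W k)ᴴ) ∧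
      ∀ k, IsIrreducible (fun i => (W k)ᴴ * A i * W k) ∧ ∃ i, (W k)ᴴ * A i * W k ≠ 0 := by
  induction N using Nat.strong_induction_on with
  | _ N ih =>
    by_cases hA0 : ∃ i, A i ≠ 0
    swap
    · push Not at hA0
      exact ⟨Empty, inferInstance, fun k => k.elim, fun k => k.elim, fun k => k.elim,
        fun k => k.elim, fun i => by simp [hA0], fun k => k.elim⟩
    by_cases hAi : IsIrreducible A
    · refine ⟨Unit, inferInstance, fun _ => N, fun _ => 1, fun _ => by simp,
        fun k l h => absurd rfl h, fun i => by simp, fun _ => ?_⟩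
      simpa using ⟨hAi, hA0⟩
    obtain ⟨P, hP, hPP, hAP, hP0, hP1⟩ : ∃ P : Matrix (Fin N) (Fin N) ℂ, P.IsHermitian ∧
        P * P = P ∧ (∀ i, A i * P = P * A i * P) ∧ P ≠ 0 ∧ P ≠ 1 := by
      unfold IsIrreducible at hAi
      push Not at hAi
      exact hAi
    -- Here block triangular becomes block diagonal, so the induction can compress to both `P` and
    -- `1 - P`.
    have hcomm := hA.commute hP hAP
    have hQ : (1 - P).IsHermitian := Matrix.isHermitian_one.sub hP
    have hQQ : (1 - P) * (1 - P) = 1 - P := by simp [sub_mul, mul_sub, hPP]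
    obtain ⟨m₁, W₁, hW₁, hWP₁⟩ := exists_isometry_of_projector hP hPP
    obtain ⟨m₂, W₂, hW₂, hWP₂⟩ := exists_isometry_of_projector hQ hQQ
    have hm : (m₁ : ℂ) + m₂ = N := by
      have h1 : (W₁ * W₁ᴴ).trace = m₁ := by
        rw [Matrix.trace_mul_comm, hW₁, Matrix.trace_one, Fintype.card_fin]
      have h2 : (W₂ * W₂ᴴ).trace = m₂ := by
        rw [Matrix.trace_mul_comm, hW₂, Matrix.trace_one, Fintype.card_fin]
      rw [← h1, ← h2, hWP₁, hWP₂, ← Matrix.trace_add, add_sub_cancel, Matrix.trace_one,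
        Fintype.card_fin]
    have hm' : m₁ + m₂ = N := by exact_mod_cast hm
    have hm₁ : m₁ ≠ 0 := by
      rintro rfl
      refine hP0 ?_
      rw [← hWP₁]
      ext i j
      simp [Matrix.mul_apply]
    have hm₂ : m₂ ≠ 0 := by
      rintro rfl
      refine hP1 (sub_eq_zero.1 ?_).symm
      rw [← hWP₂]
      ext i j
      simp [Matrix.mul_apply]
    have hW₁₂ : W₁ᴴ * W₂ = 0 := by
      calc W₁ᴴ * W₂ = W₁ᴴ * W₁ * W₁ᴴ * (W₂ * (W₂ᴴ * W₂)) := by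
            rw [hW₁, hW₂, Matrix.one_mul, Matrix.mul_one]
        _ = W₁ᴴ * ((W₁ * W₁ᴴ) * (W₂ * W₂ᴴ)) * W₂ := by simp only [Matrix.mul_assoc]
        _ = 0 := by rw [hWP₁, hWP₂, Matrix.mul_sub, Matrix.mul_one, hPP]; simp
    have hW₂₁ : W₂ᴴ * W₁ = 0 := by
      have := congrArg Matrix.conjTranspose hW₁₂
      simpa using this
    have hsum : ∀ i, A i = W₁ * (W₁ᴴ * A i * W₁) * W₁ᴴ + W₂ * (W₂ᴴ * A i * W₂) * W₂ᴴ := by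
      intro i
      have h1 : W₁ * (W₁ᴴ * A i * W₁) * W₁ᴴ = A i * P := by
        rw [hAP, ← hWP₁]
        simp only [Matrix.mul_assoc]
      have h2 : W₂ * (W₂ᴴ * A i * W₂) * W₂ᴴ = A i * (1 - P) := by
        calc W₂ * (W₂ᴴ * A i * W₂) * W₂ᴴ = (1 - P) * A i * (1 - P) := by
              rw [← hWP₂]; simp only [Matrix.mul_assoc]
          _ = A i * ((1 - P) * (1 - P)) := by
              rw [← Matrix.mul_assoc, Matrix.mul_sub (A i), hcomm, Matrix.sub_mul 1 P (A i),
                Matrix.mul_one, Matrix.one_mul]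
          _ = A i * (1 - P) := by rw [hQQ]
      rw [h1, h2, ← Matrix.mul_add, add_sub_cancel, Matrix.mul_one]
    obtain ⟨κ₁, _, D₁, V₁, hV₁, hVo₁, hVs₁, hVi₁⟩ := ih m₁ (by omega) (hA.compress W₁)
    obtain ⟨κ₂, _, D₂, V₂, hV₂, hVo₂, hVs₂, hVi₂⟩ := ih m₂ (by omega) (hA.compress W₂)
    have hassoc₁ : ∀ k i, (W₁ * V₁ k)ᴴ * A i * (W₁ * V₁ k) =
        (V₁ k)ᴴ * (W₁ᴴ * A i * W₁) * V₁ k := by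
      intro k i
      simp only [Matrix.conjTranspose_mul, Matrix.mul_assoc]
    have hassoc₂ : ∀ k i, (W₂ * V₂ k)ᴴ * A i * (W₂ * V₂ k) =
        (V₂ k)ᴴ * (W₂ᴴ * A i * W₂) * V₂ k := by
      intro k i
      simp only [Matrix.conjTranspose_mul, Matrix.mul_assoc]
    have hprod : ∀ {a b c e : ℕ} (X : Matrix (Fin N) (Fin a) ℂ) (Y : Matrix (Fin N) (Fin b) ℂ)
        (x : Matrix (Fin a) (Fin c) ℂ) (y : Matrix (Fin b) (Fin e) ℂ),
        (X * x)ᴴ * (Y * y) = xᴴ * (Xᴴ * Y) * y := by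
      intro a b c e X Y x y
      simp only [Matrix.conjTranspose_mul, Matrix.mul_assoc]
    refine ⟨κ₁ ⊕ κ₂, inferInstance, Sum.elim D₁ D₂,
      fun k => Sum.rec (motive := fun k => Matrix (Fin N) (Fin (Sum.elim D₁ D₂ k)) ℂ)
        (fun k => W₁ * V₁ k) (fun k => W₂ * V₂ k) k, ?_, ?_, ?_, ?_⟩
    · rintro (k | k)
      · change (W₁ * V₁ k)ᴴ * (W₁ * V₁ k) = 1
        rw [hprod, hW₁, Matrix.mul_one, hV₁]
      · change (W₂ * V₂ k)ᴴ * (W₂ * V₂ k) = 1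
        rw [hprod, hW₂, Matrix.mul_one, hV₂]
    · rintro (k | k) (l | l) hkl
      · change (W₁ * V₁ k)ᴴ * (W₁ * V₁ l) = 0
        rw [hprod, hW₁, Matrix.mul_one, hVo₁ k l (fun h => hkl (h ▸ rfl))]
      · change (W₁ * V₁ k)ᴴ * (W₂ * V₂ l) = 0
        rw [hprod, hW₁₂, Matrix.mul_zero, Matrix.zero_mul]
      · change (W₂ * V₂ k)ᴴ * (W₁ * V₁ l) = 0
        rw [hprod, hW₂₁, Matrix.mul_zero, Matrix.zero_mul]
      · change (W₂ * V₂ k)ᴴ * (W₂ * V₂ l) = 0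
        rw [hprod, hW₂, Matrix.mul_one, hVo₂ k l (fun h => hkl (h ▸ rfl))]
    · intro i
      rw [Fintype.sum_sum_type]
      change A i = ∑ k, W₁ * V₁ k * ((W₁ * V₁ k)ᴴ * A i * (W₁ * V₁ k)) * (W₁ * V₁ k)ᴴ +
        ∑ k, W₂ * V₂ k * ((W₂ * V₂ k)ᴴ * A i * (W₂ * V₂ k)) * (W₂ * V₂ k)ᴴ
      refine (hsum i).trans ?_
      congr 1
      · conv_lhs => rw [hVs₁ i]
        rw [Matrix.mul_sum, Matrix.sum_mul]
        refine Finset.sum_congr rfl fun k _ => ?_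
        simp only [Matrix.conjTranspose_mul, Matrix.mul_assoc]
      · conv_lhs => rw [hVs₂ i]
        rw [Matrix.mul_sum, Matrix.sum_mul]
        refine Finset.sum_congr rfl fun k _ => ?_
        simp only [Matrix.conjTranspose_mul, Matrix.mul_assoc]
    · rintro (k | k)
      · change IsIrreducible (fun i => (W₁ * V₁ k)ᴴ * A i * (W₁ * V₁ k)) ∧
          ∃ i, (W₁ * V₁ k)ᴴ * A i * (W₁ * V₁ k) ≠ 0
        simp only [hassoc₁]
        exact hVi₁ k
      · change IsIrreducible (fun i => (W₂ * V₂ k)ᴴ * A i * (W₂ * V₂ k)) ∧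
          ∃ i, (W₂ * V₂ k)ᴴ * A i * (W₂ * V₂ k) ≠ 0
        simp only [hassoc₂]
        exact hVi₂ k

end Decomposition

/-! ### Overlaps and asymptotic linear independence -/

section Gram

variable {ι n m : Type} [Fintype ι] [Fintype n] [DecidableEq n] [Fintype m] [DecidableEq m]

theorem sum_prod_ofFn {R : Type*} [Ring R] (f : ι → R) (N : ℕ) :
    ∑ w : Fin N → ι, (List.ofFn fun k => f (w k)).prod = (∑ i, f i) ^ N := by
  induction N with
  | zero => simp
  | succ N ih =>
    rw [pow_succ', ← ih, Finset.sum_mul_sum, ← Finset.sum_product', ← Equiv.sum_comp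
      (Fin.consEquiv fun _ : Fin (N + 1) => ι)]
    refine Finset.sum_congr (by ext; simp) fun w _ => ?_
    rw [List.ofFn_succ, List.prod_cons]
    simp [Fin.consEquiv]

/-- The matrix of the mixed transfer map `X ↦ ∑ i, A i * X * (B i)ᴴ`. -/
def mixedTransfer (A : Tensor ι n) (B : Tensor ι m) : Matrix (n × m) (n × m) ℂ :=
  ∑ i, A i ⊗ₖ (B i).map star

omit [Fintype ι] in
theorem prod_ofFn_kronecker (A : Tensor ι n) (B : Tensor ι m) {N : ℕ} (w : Fin N → ι) :
    (List.ofFn fun k => A (w k) ⊗ₖ (B (w k)).map star).prod =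
      (List.ofFn fun k => A (w k)).prod ⊗ₖ ((List.ofFn fun k => B (w k)).prod).map star := by
  induction N with
  | zero => simp [Matrix.map_one]
  | succ N ih =>
    have h := ih (fun k => w k.succ)
    simp only [List.ofFn_succ, List.prod_cons]
    rw [h, ← Matrix.mul_kronecker_mul]
    congr 1
    exact (Matrix.map_mul (f := starRingEnd ℂ)).symm

/-- Overlaps of matrix product vectors are traces of powers of the mixed transfer matrix. -/
theorem sum_mpv_mul_star (A : Tensor ι n) (B : Tensor ι m) (N : ℕ) :
    ∑ w, mpv A N w * star (mpv B N w) = ((mixedTransfer A B) ^ N).trace := by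
  rw [mixedTransfer, ← sum_prod_ofFn, Matrix.trace_sum]
  refine Finset.sum_congr rfl fun w _ => ?_
  rw [prod_ofFn_kronecker, Matrix.trace_kronecker]
  congr 1
  simp [mpv, Matrix.trace]

omit [DecidableEq n] [DecidableEq m] in
theorem mixedTransfer_mulVec (A : Tensor ι n) (B : Tensor ι m) (X : Matrix n m ℂ) :
    mixedTransfer A B *ᵥ (fun p => X p.1 p.2) =
      fun p => (∑ i, A i * X * (B i)ᴴ) p.1 p.2 := by
  funext p
  rw [mixedTransfer, Matrix.sum_mulVec, Finset.sum_apply, Matrix.sum_apply]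
  refine Finset.sum_congr rfl fun i _ => ?_
  simp only [Matrix.mulVec, dotProduct, Matrix.mul_apply, Matrix.kroneckerMap_apply,
    Matrix.map_apply, Matrix.conjTranspose_apply, Finset.sum_mul, Fintype.sum_prod_type]
  rw [Finset.sum_comm]
  exact Finset.sum_congr rfl fun b _ => Finset.sum_congr rfl fun a _ => by ring

theorem hasEigenvalue_mixedTransfer_iff (A : Tensor ι n) (B : Tensor ι m) (z : ℂ) :
    Module.End.HasEigenvalue (Matrix.toLin' (mixedTransfer A B)) z ↔
      ∃ X : Matrix n m ℂ, X ≠ 0 ∧ ∑ i, A i * X * (B i)ᴴ = z • X := by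
  constructor
  · intro h
    obtain ⟨x, hx⟩ := h.exists_hasEigenvector
    refine ⟨Matrix.of fun a b => x (a, b), fun h0 => hx.2 ?_, ?_⟩
    · funext p
      exact congrFun (congrFun h0 p.1) p.2
    · have h1 := mixedTransfer_mulVec A B (Matrix.of fun a b => x (a, b))
      have h2 := hx.apply_eq_smul
      rw [Matrix.toLin'_apply] at h2
      ext a b
      have h3 := congrFun (h1.symm.trans h2) (a, b)
      exact h3
  · rintro ⟨X, hX0, hX⟩
    refine Module.End.hasEigenvalue_of_hasEigenvector (x := fun p => X p.1 p.2)
      ⟨Module.End.mem_eigenspace_iff.2 ?_, fun h0 => hX0 ?_⟩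
    · rw [Matrix.toLin'_apply, mixedTransfer_mulVec, hX]
      rfl
    · ext a b
      exact congrFun h0 (a, b)

open Filter Topology

theorem tendsto_sum_mul_pow {s : Finset ℂ} (c : ℂ → ℂ) (hs : ∀ z ∈ s, ‖z‖ < 1 ∨ z = 1) :
    Tendsto (fun N : ℕ => ∑ z ∈ s, c z * z ^ N) atTop (𝓝 (∑ z ∈ s, if z = 1 then c 1 else 0)) := by
  refine tendsto_finsetSum _ fun z hz => ?_
  by_cases h1 : z = 1
  · subst h1
    simp
  · rw [if_neg h1]
    have h2 := (hs z hz).resolve_right h1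
    simpa using (tendsto_pow_atTop_nhds_zero_of_norm_lt_one h2).const_mul (c z)

/-- Without a unitary equivalence all eigenvalues of the mixed transfer map lie strictly inside the
unit disc, so the traces of its powers decay. -/
theorem IsPerronBlock.tendsto_overlap_zero {S : Set (ι → ℂ)} {A : Tensor ι n} {B : Tensor ι m}
    (hA : IsPerronBlock S A) (hB : IsPerronBlock S B)
    (hAB : ¬ ∃ T : Matrix n m ℂ, Tᴴ * T = 1 ∧ T * Tᴴ = 1 ∧ ∀ i, A i * T = T * B i) :
    Tendsto (fun N => ∑ w, mpv A N w * star (mpv B N w)) atTop (𝓝 0) := by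
  obtain ⟨s, c, hs, -, htr⟩ := trace_pow_eq_sum (Matrix.toLin' (mixedTransfer A B))
  have h1 : ∀ z ∈ s, ‖z‖ < 1 := by
    intro z hz
    obtain ⟨X, hX0, hX⟩ := (hasEigenvalue_mixedTransfer_iff A B z).1 ((hs z).1 hz)
    have h := hA.mixed_eigenvalue hB hX0 hX
    exact lt_of_le_of_ne h.1 fun h2 => hAB (h.2 h2).2
  have h2 := tendsto_sum_mul_pow (fun z => (c z : ℂ)) fun z hz => Or.inl (h1 z hz)
  rw [Finset.sum_eq_zero fun z hz => if_neg (by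
    rintro rfl
    simpa using h1 1 hz)] at h2
  refine h2.congr fun N => ?_
  rw [sum_mpv_mul_star, ← htr, ← Matrix.toLin'_pow, Matrix.trace_toLin'_eq]

/-- The limit is the algebraic multiplicity of the eigenvalue `1`; positivity of this number
suffices later. -/
theorem IsPerronBlock.tendsto_overlap_self {S : Set (ι → ℂ)} {A : Tensor ι n}
    (hA : IsPerronBlock S A) :
    ∃ c : ℕ, 0 < c ∧ Tendsto (fun N => ∑ w, mpv A N w * star (mpv A N w)) atTop (𝓝 c) := by
  obtain ⟨s, c, hs, hc, htr⟩ := trace_pow_eq_sum (Matrix.toLin' (mixedTransfer A A))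
  have h1 : ∀ z ∈ s, ‖z‖ < 1 ∨ z = 1 := by
    intro z hz
    obtain ⟨X, hX0, hX⟩ := (hasEigenvalue_mixedTransfer_iff A A z).1 ((hs z).1 hz)
    have h := hA.mixed_eigenvalue hA hX0 hX
    rcases h.1.lt_or_eq with h2 | h2
    · exact Or.inl h2
    · exact Or.inr (h.2 h2).1
  have h1s : (1 : ℂ) ∈ s := by
    obtain ⟨σ, ρ, -, hρ, h2, -⟩ := hA.perron
    refine (hs 1).2 ((hasEigenvalue_mixedTransfer_iff A A 1).2 ⟨ρ, fun h0 => ?_, ?_⟩)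
    · obtain ⟨i⟩ := hA.nonempty
      have := hρ.diag_pos (i := i)
      rw [h0] at this
      exact lt_irrefl _ this
    · rw [one_smul]; exact h2
  have h2 := tendsto_sum_mul_pow (fun z => (c z : ℂ)) h1
  rw [Finset.sum_ite_eq' s 1, if_pos h1s] at h2
  refine ⟨c 1, hc 1 h1s, h2.congr fun N => ?_⟩
  rw [sum_mpv_mul_star, ← htr, ← Matrix.toLin'_pow, Matrix.trace_toLin'_eq]

/-- Matrix product vectors of pairwise inequivalent blocks are linearly independent for all
sufficiently large system sizes. -/
theorem exists_linearIndependent_mpv {S : Set (ι → ℂ)} {g : ℕ} {D : Fin g → ℕ}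
    (B : (j : Fin g) → Tensor ι (Fin (D j))) (hB : ∀ j, IsPerronBlock S (B j))
    (hne : ∀ j k, j ≠ k → ¬ ∃ T : Matrix (Fin (D j)) (Fin (D k)) ℂ,
      Tᴴ * T = 1 ∧ T * Tᴴ = 1 ∧ ∀ i, B j i * T = T * B k i) :
    ∃ N₀ : ℕ, ∀ N : ℕ, N₀ < N → LinearIndependent ℂ fun j => mpv (B j) N := by
  let G : ℕ → Matrix (Fin g) (Fin g) ℂ := fun N =>
    Matrix.of fun j k => ∑ w, mpv (B j) N w * star (mpv (B k) N w)
  -- Off-diagonal overlaps tend to zero and diagonal ones to positive limits, so the Gram matrix is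
  -- eventually strictly diagonally dominant by columns.
  have h1 : ∀ᶠ N in atTop, ∀ k, ∑ j ∈ Finset.univ.erase k, ‖G N j k‖ < ‖G N k k‖ := by
    rw [eventually_all]
    intro k
    obtain ⟨c, hc, h2⟩ := (hB k).tendsto_overlap_self
    have h3 : Tendsto (fun N => ∑ j ∈ Finset.univ.erase k, ‖G N j k‖) atTop
        (𝓝 (∑ j ∈ Finset.univ.erase k, ‖(0 : ℂ)‖)) :=
      tendsto_finsetSum _ fun j hj =>
        ((hB j).tendsto_overlap_zero (hB k) (hne j k (Finset.ne_of_mem_erase hj))).norm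
    refine h3.eventually_lt h2.norm ?_
    simpa using hc
  obtain ⟨N₀, hN₀⟩ := eventually_atTop.1 h1
  refine ⟨N₀, fun N hN => ?_⟩
  have hdet := det_ne_zero_of_sum_col_lt_diag (hN₀ N hN.le)
  rw [Fintype.linearIndependent_iff]
  intro c hc
  have h2 : c ᵥ* G N = 0 := by
    funext k
    have h3 : ∀ w, ∑ j, c j * mpv (B j) N w = 0 := by
      intro w
      have := congrFun hc w
      simpa using this
    simp only [Matrix.vecMul, dotProduct, G, Matrix.of_apply, Finset.mul_sum, Pi.zero_apply]
    rw [Finset.sum_comm]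
    refine Finset.sum_eq_zero fun w _ => ?_
    simp only [← mul_assoc]
    rw [← Finset.sum_mul, h3, zero_mul]
  exact congrFun (Matrix.eq_zero_of_vecMul_eq_zero hdet h2)

end Gram

/-! ### Nondegeneracy of the trace form -/

section TraceForm

variable {ι n κ : Type} [Fintype ι] [Fintype n] [DecidableEq n] [Fintype κ]

omit [Fintype ι] in
theorem trace_mul_eq_zero_of_mem_adjoin {A : Tensor ι n} {X : Matrix n n ℂ}
    (h : ∀ l : List ι, (X * (l.map A).prod).trace = 0) {a : Matrix n n ℂ}
    (ha : a ∈ Algebra.adjoin ℂ (Set.range A)) : (X * a).trace = 0 := by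
  rw [← Subalgebra.mem_toSubmodule, Algebra.adjoin_eq_span] at ha
  let L : Matrix n n ℂ →ₗ[ℂ] ℂ := Matrix.traceLinearMap n ℂ ℂ ∘ₗ LinearMap.mulLeft ℂ X
  suffices h1 : Submodule.span ℂ (Submonoid.closure (Set.range A) : Set (Matrix n n ℂ)) ≤
      LinearMap.ker L from h1 ha
  rw [Submodule.span_le]
  intro y hy
  obtain ⟨l, hl, rfl⟩ := Submonoid.exists_list_of_mem_closure hy
  obtain ⟨l', rfl⟩ : ∃ l' : List ι, l = l'.map A := by
    have : l ∈ Set.range (List.map A) := by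
      rw [Set.range_list_map]
      exact hl
    obtain ⟨l', h⟩ := this
    exact ⟨l', h.symm⟩
  exact h l'

/-- The trace form is nondegenerate on the span of a direct sum of irreducible tensors. -/
theorem eq_zero_of_trace_mul_prod {D : κ → ℕ} {A : Tensor ι n}
    {C : (k : κ) → Tensor ι (Fin (D k))} {W : (k : κ) → Matrix n (Fin (D k)) ℂ}
    (hW : ∀ k, (W k)ᴴ * W k = 1) (hAW : ∀ k i, A i * W k = W k * C k i)
    (hA : ∀ i, A i = ∑ k, W k * C k i * (W k)ᴴ) (hC : ∀ k, IsIrreducible (C k)) (c : ι → ℂ)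
    (h : ∀ l : List ι, ((∑ i, c i • A i) * (l.map A).prod).trace = 0) : ∑ i, c i • A i = 0 := by
  set X := ∑ i, c i • A i with hX
  have hXW : ∀ k, X * W k = W k * ∑ i, c i • C k i := by
    intro k
    simp only [hX, Matrix.sum_mul, Matrix.mul_sum, Matrix.smul_mul, Matrix.mul_smul, hAW]
  have hXs : X = ∑ k, W k * (∑ i, c i • C k i) * (W k)ᴴ := by
    rw [hX]
    simp only [Matrix.sum_mul, Matrix.mul_sum, Matrix.smul_mul, Matrix.mul_smul]
    rw [Finset.sum_comm]
    refine Finset.sum_congr rfl fun i _ => ?_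
    rw [hA i, Finset.smul_sum]
  suffices hXk : ∀ k, ∑ i, c i • C k i = 0 by
    rw [hXs]
    simp [hXk]
  intro k
  by_contra hne
  obtain ⟨v, hv⟩ : ∃ v, (∑ i, c i • C k i) *ᵥ v ≠ 0 := by
    by_contra hall
    push Not at hall
    exact hne (Matrix.ext_of_mulVec_single fun j => by rw [hall, Matrix.zero_mulVec])
  set w := (∑ i, c i • C k i) *ᵥ v with hw
  -- The vectors of block `k` reachable from `w` under the algebra generated by the whole tensor;
  -- this space is invariant and contains `w ≠ 0`, so it also contains `v`.
  let p : Submodule ℂ (Fin (D k) → ℂ) :=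
    { carrier := {u | ∃ a ∈ Algebra.adjoin ℂ (Set.range A), a *ᵥ (W k *ᵥ w) = W k *ᵥ u}
      add_mem' := by
        rintro u u' ⟨a, ha, hau⟩ ⟨b, hb, hbu⟩
        exact ⟨a + b, add_mem ha hb, by rw [Matrix.add_mulVec, hau, hbu, Matrix.mulVec_add]⟩
      zero_mem' := ⟨0, zero_mem _, by simp⟩
      smul_mem' := by
        rintro x u ⟨a, ha, hau⟩
        exact ⟨x • a, Subalgebra.smul_mem _ ha x, by
          rw [Matrix.smul_mulVec, hau, Matrix.mulVec_smul]⟩ }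
  have hp : p = ⊥ ∨ p = ⊤ := (hC k).eq_bot_or_eq_top p (by
    rintro i u ⟨a, ha, hau⟩
    refine ⟨A i * a, mul_mem (Algebra.subset_adjoin (Set.mem_range_self i)) ha, ?_⟩
    rw [← Matrix.mulVec_mulVec, hau, Matrix.mulVec_mulVec, Matrix.mulVec_mulVec, hAW])
  have hwp : w ∈ p := ⟨1, one_mem _, by rw [Matrix.one_mulVec]⟩
  rcases hp with hp | hp
  · rw [hp, Submodule.mem_bot] at hwp
    exact hv hwp
  obtain ⟨a, ha, hav⟩ : v ∈ p := hp ▸ Submodule.mem_top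
  have hXmem : X ∈ Algebra.adjoin ℂ (Set.range A) :=
    sum_mem fun i _ => Subalgebra.smul_mem _ (Algebra.subset_adjoin (Set.mem_range_self i)) _
  -- `X` sends `W k v` to `W k w`, and `a` sends it back.
  have hev : Module.End.HasEigenvalue (Matrix.toLin' (a * X)) 1 := by
    refine Module.End.hasEigenvalue_of_hasEigenvector (x := W k *ᵥ v)
      ⟨Module.End.mem_eigenspace_iff.2 ?_, fun h0 => hv ?_⟩
    · rw [one_smul, Matrix.toLin'_apply, Matrix.mulVec_mulVec, Matrix.mul_assoc, hXW,
        ← Matrix.mulVec_mulVec, ← Matrix.mulVec_mulVec, ← hw, hav]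
    · have h1 : (W k)ᴴ *ᵥ (W k *ᵥ v) = v := by
        rw [Matrix.mulVec_mulVec, hW, Matrix.one_mulVec]
      rw [h0, Matrix.mulVec_zero] at h1
      rw [hw, ← h1, Matrix.mulVec_zero]
  refine one_ne_zero (eq_zero_of_hasEigenvalue_of_trace_pow (fun N hN => ?_) hev)
  obtain ⟨N, rfl⟩ := Nat.exists_eq_succ_of_ne_zero (by omega : N ≠ 0)
  rw [← Matrix.toLin'_pow, Matrix.trace_toLin'_eq, Nat.succ_eq_add_one, pow_succ,
    ← Matrix.mul_assoc, Matrix.trace_mul_comm]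
  exact trace_mul_eq_zero_of_mem_adjoin h (mul_mem (pow_mem (mul_mem ha hXmem) N) ha)

theorem IsCanonicalForm.eq_zero_of_trace_mul_prod {A : Tensor ι n} (hA : IsCanonicalForm A)
    (c : ι → ℂ) (h : ∀ l : List ι, ((∑ i, c i • A i) * (l.map A).prod).trace = 0) :
    ∑ i, c i • A i = 0 := by
  obtain ⟨r, D, μ, B, V, hV, hμ, hB, hAV⟩ := hA
  let W : (k : Fin r) → Matrix n (Fin (D k)) ℂ := fun k => V.submatrix id fun a => ⟨k, a⟩
  have hWs : ∀ i, A i = ∑ k, W k * (μ k • B k i) * (W k)ᴴ := by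
    intro i
    rw [hAV]
    ext x y
    simp only [Matrix.mul_apply, Matrix.sum_apply, Fintype.sum_sigma, W, Matrix.submatrix_apply,
      id, Matrix.conjTranspose_apply]
    refine Finset.sum_congr rfl fun k _ => Finset.sum_congr rfl fun a _ => ?_
    congr 1
    rw [Finset.sum_eq_single k]
    · simp
    · intro l _ hl
      refine Finset.sum_eq_zero fun b _ => ?_
      rw [Matrix.blockDiagonal'_apply_ne _ _ _ hl, mul_zero]
    · simp
  have hWW : ∀ k l (a : Fin (D k)) (b : Fin (D l)), ((W k)ᴴ * W l) a b =
      (1 : Matrix ((k : Fin r) × Fin (D k)) ((k : Fin r) × Fin (D k)) ℂ) ⟨k, a⟩ ⟨l, b⟩ := by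
    intro k l a b
    rw [← hV]
    simp [Matrix.mul_apply, W]
  have hW1 : ∀ k, (W k)ᴴ * W k = 1 := by
    intro k
    ext a b
    rw [hWW]
    simp [Matrix.one_apply]
  have hW0 : ∀ k l, k ≠ l → (W k)ᴴ * W l = 0 := by
    intro k l hkl
    ext a b
    rw [hWW, Matrix.one_apply_ne (by simp [hkl])]
    rfl
  refine MPDO.eq_zero_of_trace_mul_prod (C := fun k i => μ k • B k i) hW1 (fun k i => ?_) hWs
    (fun k => (show IsIrreducible (B k) from (hB k).irreducible).smul (hμ k)) c h
  rw [hWs, Matrix.sum_mul, Finset.sum_eq_single k]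
  · rw [Matrix.mul_assoc, hW1, Matrix.mul_one]
  · intro l _ hl
    rw [Matrix.mul_assoc, hW0 l k hl, Matrix.mul_zero]
  · simp

end TraceForm

/-! ### From positive operators to positive vertical combinations -/

section Slices

theorem eq_zero_of_dotProduct_mulVec_self {n : Type} [Fintype n] [DecidableEq n]
    {F : Matrix n n ℂ} (h : ∀ u, star u ⬝ᵥ F *ᵥ u = 0) : F = 0 := by
  have h1 : Matrix.toEuclideanLin F = 0 := by
    rw [← inner_map_self_eq_zero]
    intro x
    rw [← inner_conj_symm, map_eq_zero]
    have := h (WithLp.ofLp x)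
    rw [EuclideanSpace.inner_eq_star_dotProduct, dotProduct_comm]
    exact this
  simpa using h1

variable {d D : ℕ}

/-- Contracting all sites but one with a vector leaves a combination of the vertical matrices. -/
theorem sum_smul_vertical_apply (M : Fin d → Fin d → Fin D → Fin D → ℂ) (R : Matrix (Fin D) (Fin D) ℂ)
    (i j : Fin d) : (∑ p : Fin D × Fin D, R p.2 p.1 • vertical M p) i j =
      (horizontal M (i, j) * R).trace := by
  rw [Matrix.sum_apply, Fintype.sum_prod_type, Matrix.trace]
  refine Finset.sum_congr rfl fun a _ => ?_
  rw [Matrix.diag_apply, Matrix.mul_apply]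
  refine Finset.sum_congr rfl fun b _ => ?_
  simp [vertical, horizontal, mul_comm]

/-- This matrix is the compression of `ρ` by the map `x ↦ x ⊗ u`. -/
theorem posSemidef_slice {d : ℕ} {T : Type} [Fintype T] {ρ : Matrix (Fin d × T) (Fin d × T) ℂ}
    (hρ : ρ.PosSemidef) (u : T → ℂ) :
    (Matrix.of fun i j => ∑ x, ∑ y, star (u x) * u y * ρ (i, x) (j, y)).PosSemidef := by
  let K : Matrix (Fin d × T) (Fin d) ℂ := Matrix.of fun p i => if p.1 = i then u p.2 else 0
  convert hρ.conjTranspose_mul_mul_same K using 1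
  ext i j
  simp only [K, Matrix.mul_apply, Matrix.conjTranspose_apply, Matrix.of_apply,
    Fintype.sum_prod_type, Finset.sum_mul, apply_ite star, star_zero, ite_mul, zero_mul, mul_ite,
    mul_zero]
  rw [Finset.sum_eq_single j (fun k _ hk => by simp [hk]) (by simp), Finset.sum_comm]
  refine Finset.sum_congr rfl fun y _ => ?_
  rw [if_pos rfl, Finset.sum_eq_single i (fun k _ hk => by simp [hk]) (by simp)]
  refine Finset.sum_congr rfl fun x _ => ?_
  rw [if_pos rfl]
  ring

/-- If the horizontal tensor is in canonical form and generates density operators, then the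
vertical matrices are spanned by positive semidefinite ones. -/
theorem posGenerated_vertical (M : Fin d → Fin d → Fin D → Fin D → ℂ)
    (hCF : IsCanonicalForm (horizontal M)) (hM : GeneratesMPDO M) :
    PosGenerated {c | (∑ p, c p • vertical M p).PosSemidef} (vertical M) := by
  refine ⟨fun c hc => hc, fun q => ?_⟩
  by_contra hq
  -- Duality: a functional separating a vertical matrix from the span of the positive combinations.
  obtain ⟨φ, hφq, hφ⟩ := Submodule.exists_le_ker_of_notMem hq
  let f : Fin d × Fin d → ℂ := fun p => φ (Matrix.single p.1 p.2 1)
  have hφf : ∀ Z, φ Z = ∑ p : Fin d × Fin d, f p * Z p.1 p.2 := by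
    intro Z
    conv_lhs => rw [Matrix.matrix_eq_sum_single Z]
    rw [map_sum, Fintype.sum_prod_type]
    refine Finset.sum_congr rfl fun i _ => ?_
    rw [map_sum]
    refine Finset.sum_congr rfl fun j _ => ?_
    rw [← mul_one (Z i j), ← smul_eq_mul, ← Matrix.smul_single, map_smul, smul_eq_mul, mul_comm,
      smul_eq_mul, mul_one]
  have hX : ∑ p, f p • horizontal M p = 0 := by
    refine hCF.eq_zero_of_trace_mul_prod f fun l => ?_
    -- The partial contraction of the operator on `l.length + 1` sites with `f` at the first site.
    -- Its quadratic form at `u` is `φ` of a positive slice, hence zero, and over `ℂ` this forces `F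
    -- = 0`.
    let F : Matrix (Fin l.length → Fin d) (Fin l.length → Fin d) ℂ := Matrix.of fun x y =>
      ((∑ p, f p • horizontal M p) * (List.ofFn fun k => horizontal M (x k, y k)).prod).trace
    have hF : F = 0 := by
      refine eq_zero_of_dotProduct_mulVec_self fun u => ?_
      let R : Matrix (Fin D) (Fin D) ℂ := ∑ x, ∑ y, (star (u x) * u y) •
        (List.ofFn fun k => horizontal M (x k, y k)).prod
      have h1 : φ (∑ p : Fin D × Fin D, R p.2 p.1 • vertical M p) = 0 := by
        refine hφ (Submodule.subset_span ⟨fun p => R p.2 p.1, ?_, rfl⟩)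
        have h2 := (hM (l.length + 1) (by omega)).submatrix
          (Fin.consEquiv fun _ : Fin (l.length + 1) => Fin d)
        have h3 : (∑ p : Fin D × Fin D, R p.2 p.1 • vertical M p).PosSemidef := by
          convert posSemidef_slice h2 u using 1
          ext i j
          rw [sum_smul_vertical_apply]
          simp only [R, Matrix.mul_sum, Matrix.trace_sum, Matrix.mul_smul, Matrix.trace_smul,
            smul_eq_mul, Matrix.of_apply, Matrix.submatrix_apply, mpo, mpv, List.ofFn_succ,
            List.prod_cons, Fin.consEquiv]
          rfl
        exact h3
      rw [hφf] at h1
      simp only [sum_smul_vertical_apply] at h1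
      have h2 : ∑ p, f p * (horizontal M p * R).trace =
          ((∑ p, f p • horizontal M p) * R).trace := by
        simp [Matrix.sum_mul, Matrix.trace_sum]
      have h3 : ((∑ p, f p • horizontal M p) * R).trace =
          ∑ x, ∑ y, star (u x) * u y * F x y := by
        simp only [R, F, Matrix.mul_sum (M := ∑ p, f p • horizontal M p), Matrix.trace_sum,
          Matrix.mul_smul, Matrix.trace_smul, smul_eq_mul, Matrix.of_apply]
      rw [← h1, h2, h3]
      simp only [dotProduct, Matrix.mulVec, Finset.mul_sum, Pi.star_apply]
      exact Finset.sum_congr rfl fun x _ => Finset.sum_congr rfl fun y _ => by ring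
    have h3 := congrFun (congrFun hF fun k => (l.get k).1) fun k => (l.get k).2
    have h4 : (List.ofFn fun k => horizontal M ((l.get k).1, (l.get k).2)) =
        l.map (horizontal M) := by
      conv_rhs => rw [← List.ofFn_get l, List.map_ofFn]
      rfl
    simp only [F, Matrix.of_apply] at h3
    rw [h4] at h3
    exact h3
  refine hφq ?_
  rw [hφf]
  have h5 := congrFun (congrFun hX q.1) q.2
  simpa [Matrix.sum_apply, horizontal, vertical] using h5

end Slices

/-! ### Orthogonal sums of blocks and their block diagonal form -/

section OrthogonalSum

variable {ι n κ : Type} [Fintype n] [DecidableEq n] [Fintype κ]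

/-- A tensor which is an orthogonal direct sum of multiples of given blocks. -/
structure IsOrthogonalSum {D : κ → ℕ} (A : Tensor ι n) (ν : κ → ℂ)
    (B : (k : κ) → Tensor ι (Fin (D k))) (W : (k : κ) → Matrix n (Fin (D k)) ℂ) : Prop where
  isometry : ∀ k, (W k)ᴴ * W k = 1
  orthogonal : ∀ k l, k ≠ l → (W k)ᴴ * W l = 0
  eq_sum : ∀ i, A i = ∑ k, W k * (ν k • B k i) * (W k)ᴴ

variable {D : κ → ℕ} {A : Tensor ι n} {ν : κ → ℂ} {B : (k : κ) → Tensor ι (Fin (D k))}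
  {W : (k : κ) → Matrix n (Fin (D k)) ℂ}

omit [DecidableEq n] in
theorem IsOrthogonalSum.mul_eq (h : IsOrthogonalSum A ν B W) (i : ι) (k : κ) :
    A i * W k = ν k • (W k * B k i) := by
  rw [h.eq_sum, Matrix.sum_mul, Finset.sum_eq_single k]
  · rw [Matrix.mul_assoc, h.isometry, Matrix.mul_one, Matrix.mul_smul]
  · intro l _ hl
    rw [Matrix.mul_assoc, h.orthogonal l k hl, Matrix.mul_zero]
  · simp

theorem IsOrthogonalSum.prod_mul_eq (h : IsOrthogonalSum A ν B W) (l : List ι) (k : κ) :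
    (l.map A).prod * W k = ν k ^ l.length • (W k * (l.map (B k)).prod) := by
  induction l with
  | nil => simp
  | cons i l ih =>
    rw [List.map_cons, List.prod_cons, Matrix.mul_assoc, ih, Matrix.mul_smul, ← Matrix.mul_assoc,
      h.mul_eq, List.map_cons, List.prod_cons, List.length_cons, Matrix.smul_mul, smul_smul,
      pow_succ, Matrix.mul_assoc]

/-- Expanding one factor into blocks lets the remaining factors be pulled through `W k`. At least
one factor is needed: for `N = 0` the trace of the identity would also count the zero block. -/
theorem IsOrthogonalSum.mpv_eq (h : IsOrthogonalSum A ν B W) {N : ℕ} (hN : 1 ≤ N) :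
    mpv A N = ∑ k, ν k ^ N • mpv (B k) N := by
  obtain ⟨N, rfl⟩ := Nat.exists_eq_succ_of_ne_zero (by omega : N ≠ 0)
  funext w
  rw [Finset.sum_apply]
  have hl : ∀ {m : Type} [Fintype m] [DecidableEq m] (C : Tensor ι m), mpv C (N + 1) w =
      (C (w 0) * ((List.ofFn fun k : Fin N => w k.succ).map C).prod).trace := by
    intro m _ _ C
    rw [mpv, List.ofFn_succ, List.prod_cons, List.map_ofFn]
    rfl
  simp only [Nat.succ_eq_add_one, Pi.smul_apply, hl]
  rw [Matrix.trace_mul_comm, h.eq_sum, Matrix.mul_sum, Matrix.trace_sum]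
  refine Finset.sum_congr rfl fun k _ => ?_
  rw [← Matrix.mul_assoc, ← Matrix.mul_assoc, h.prod_mul_eq, List.length_ofFn, Matrix.mul_smul,
    Matrix.smul_mul, Matrix.smul_mul, Matrix.smul_mul, smul_smul, Matrix.trace_smul, ← pow_succ',
    Matrix.trace_mul_comm, ← Matrix.mul_assoc, ← Matrix.mul_assoc, h.isometry, Matrix.one_mul,
    Matrix.trace_mul_comm]

omit [DecidableEq n] in
theorem IsOrthogonalSum.isCanonicalForm [Fintype ι] (h : IsOrthogonalSum A ν B W)
    (hν : ∀ k, ν k ≠ 0) (hB : ∀ k, IsNormal (B k)) : IsCanonicalForm A := by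
  let e := (Fintype.equivFin κ).symm
  refine ⟨Fintype.card κ, fun k => D (e k), fun k => ν (e k), fun k => B (e k),
    Matrix.of fun x p => W (e p.1) x p.2, ?_, fun k => hν _, fun k => hB _, fun i => ?_⟩
  · ext ⟨k, a⟩ ⟨l, b⟩
    have h1 : ∀ k l a b, ((W (e k))ᴴ * W (e l)) a b = ((Matrix.of fun x (p : (k : Fin
        (Fintype.card κ)) × Fin (D (e k))) => W (e p.1) x p.2)ᴴ *
        (Matrix.of fun x (p : (k : Fin (Fintype.card κ)) × Fin (D (e k))) => W (e p.1) x p.2))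
        ⟨k, a⟩ ⟨l, b⟩ := by
      intro k l a b
      simp [Matrix.mul_apply]
    rw [← h1]
    by_cases hkl : k = l
    · subst hkl
      rw [h.isometry]
      simp [Matrix.one_apply]
    · rw [h.orthogonal _ _ (e.injective.ne hkl), Matrix.one_apply_ne (by simp [hkl])]
      rfl
  · rw [h.eq_sum, ← Equiv.sum_comp e]
    ext x y
    simp only [Matrix.mul_apply, Matrix.sum_apply, Fintype.sum_sigma, Matrix.of_apply,
      Matrix.conjTranspose_apply]
    refine Finset.sum_congr rfl fun k _ => Finset.sum_congr rfl fun a _ => ?_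
    congr 1
    rw [Finset.sum_eq_single k]
    · simp
    · intro l _ hl
      refine Finset.sum_eq_zero fun b _ => ?_
      rw [Matrix.blockDiagonal'_apply_ne _ _ _ hl, mul_zero]
    · simp

omit [DecidableEq n] in
theorem IsOrthogonalSum.exists_blockDiagonal {g : ℕ} {m n' : Fin g → ℕ}
    {ν : ((α : Fin g) × Fin (m α)) → ℂ} {B : (α : Fin g) → Tensor ι (Fin (n' α))}
    {W : (s : (α : Fin g) × Fin (m α)) → Matrix n (Fin (n' s.1)) ℂ}
    (h : IsOrthogonalSum A ν (fun s => B s.1) W) :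
    ∃ U : Matrix ((α : Fin g) × (Fin (m α) × Fin (n' α))) n ℂ, U * Uᴴ = 1 ∧
      ∀ i, A i = Uᴴ * (Matrix.blockDiagonal' fun α =>
        Matrix.diagonal (fun q => ν ⟨α, q⟩) ⊗ₖ B α i) * U := by
  let U : Matrix ((α : Fin g) × (Fin (m α) × Fin (n' α))) n ℂ :=
    Matrix.of fun p x => star (W ⟨p.1, p.2.1⟩ x p.2.2)
  refine ⟨U, ?_, fun i => ?_⟩
  · ext ⟨α, q, a⟩ ⟨β, r, b⟩
    have h1 : (U * Uᴴ) ⟨α, q, a⟩ ⟨β, r, b⟩ = ((W ⟨α, q⟩)ᴴ * W ⟨β, r⟩) a b := by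
      simp [U, Matrix.mul_apply]
    rw [h1]
    by_cases hs : (⟨α, q⟩ : (α : Fin g) × Fin (m α)) = ⟨β, r⟩
    · obtain ⟨rfl, hqr⟩ := Sigma.mk.inj_iff.1 hs
      obtain rfl := eq_of_heq hqr
      rw [h.isometry]
      simp [Matrix.one_apply]
    · rw [h.orthogonal _ _ hs, Matrix.one_apply_ne]
      · rfl
      · rintro heq
        refine hs ?_
        obtain ⟨rfl, h2⟩ := Sigma.mk.inj_iff.1 heq
        rw [(Prod.mk.inj (eq_of_heq h2)).1]
  · rw [h.eq_sum]
    ext x y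
    simp only [Matrix.mul_apply, Matrix.sum_apply, Fintype.sum_sigma, Fintype.sum_prod_type,
      Matrix.conjTranspose_apply, U, Matrix.of_apply, star_star]
    refine Finset.sum_congr rfl fun α _ => Finset.sum_congr rfl fun q _ =>
      Finset.sum_congr rfl fun a _ => ?_
    congr 1
    rw [Finset.sum_eq_single α]
    · rw [Finset.sum_eq_single q]
      · simp [Matrix.blockDiagonal'_apply_eq]
      · intro r _ hr
        refine Finset.sum_eq_zero fun b _ => ?_
        rw [Matrix.blockDiagonal'_apply_eq, Matrix.kroneckerMap_apply, Matrix.diagonal_apply_ne _ hr,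
          zero_mul, mul_zero]
      · simp
    · intro β _ hβ
      refine Finset.sum_eq_zero fun r _ => Finset.sum_eq_zero fun b _ => ?_
      rw [Matrix.blockDiagonal'_apply_ne _ _ _ hβ, mul_zero]
    · simp

end OrthogonalSum

/-! ### Grouping equivalent blocks -/

/-- The classes of an equivalence relation on a finite type, enumerated with representatives. -/
theorem exists_enumeration_classes {κ : Type} [Fintype κ] (s : Setoid κ) :
    ∃ (g : ℕ) (m : Fin g → ℕ) (e : ((α : Fin g) × Fin (m α)) ≃ κ) (rep : Fin g → κ),
      (∀ α, 0 < m α) ∧ (∀ α q, s.r (e ⟨α, q⟩) (rep α)) ∧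
      ∀ α β, α ≠ β → ¬ s.r (rep α) (rep β) := by
  classical
  let eQ := Fintype.equivFin (Quotient s)
  let f : κ → Fin (Fintype.card (Quotient s)) := fun k => eQ ⟦k⟧
  let rep : Fin (Fintype.card (Quotient s)) → κ := fun α => (eQ.symm α).out
  have hrep : ∀ α, f (rep α) = α := fun α => by simp [f, rep]
  refine ⟨Fintype.card (Quotient s), fun α => Fintype.card {k // f k = α},
    (Equiv.sigmaCongrRight fun α => (Fintype.equivFin {k // f k = α}).symm).trans
      (Equiv.sigmaFiberEquiv f), rep, fun α => ?_, fun α q => ?_, fun α β hαβ h => ?_⟩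
  · exact Fintype.card_pos_iff.2 ⟨⟨rep α, hrep α⟩⟩
  · have h1 := ((Fintype.equivFin {k // f k = α}).symm q).2
    exact Quotient.exact (eQ.injective (h1.trans (hrep α).symm))
  · refine hαβ ?_
    rw [← hrep α, ← hrep β]
    exact congrArg eQ (Quotient.sound h)

/-- A positively generated tensor is an orthogonal direct sum of positive multiples of pairwise
inequivalent blocks. -/
theorem PosGenerated.exists_isOrthogonalSum {ι : Type} [Fintype ι] {S : Set (ι → ℂ)} {d : ℕ}
    {A : Tensor ι (Fin d)} (hA : PosGenerated S A) :
    ∃ (g : ℕ) (m n : Fin g → ℕ) (μ : (α : Fin g) → Fin (m α) → ℝ)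
      (B : (α : Fin g) → Tensor ι (Fin (n α)))
      (W : (s : (α : Fin g) × Fin (m α)) → Matrix (Fin d) (Fin (n s.1)) ℂ),
      (∀ α, 0 < m α) ∧ (∀ α q, 0 < μ α q) ∧ (∀ α, IsPerronBlock S (B α)) ∧
      (∀ α β, α ≠ β → ¬ ∃ T : Matrix (Fin (n α)) (Fin (n β)) ℂ,
        Tᴴ * T = 1 ∧ T * Tᴴ = 1 ∧ ∀ i, B α i * T = T * B β i) ∧
      IsOrthogonalSum A (fun s : (α : Fin g) × Fin (m α) => (μ s.1 s.2 : ℂ))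
        (fun s => B s.1) W := by
  obtain ⟨κ, _, D, V, hV, hVo, hVs, hVi⟩ := hA.exists_decomposition
  choose s hs hB using fun k =>
    exists_isPerronBlock_smul (hA.compress (V k)) (hVi k).1 (hVi k).2
  let B : (k : κ) → Tensor ι (Fin (D k)) := fun k i => (s k : ℂ) • ((V k)ᴴ * A i * V k)
  have hBV : ∀ k i, (V k)ᴴ * A i * V k = (((s k)⁻¹ : ℝ) : ℂ) • B k i := by
    intro k i
    rw [smul_smul, ← Complex.ofReal_mul, inv_mul_cancel₀ (hs k).ne', Complex.ofReal_one, one_smul]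
  let r : Setoid κ :=
    { r := fun k l => ∃ T : Matrix (Fin (D k)) (Fin (D l)) ℂ,
        Tᴴ * T = 1 ∧ T * Tᴴ = 1 ∧ ∀ i, B k i * T = T * B l i
      iseqv :=
        { refl := fun k => ⟨1, by simp, by simp, fun i => by simp⟩
          symm := by
            rintro k l ⟨T, h1, h2, h3⟩
            refine ⟨Tᴴ, by simpa using h2, by simpa using h1, fun i => ?_⟩
            calc B l i * Tᴴ = Tᴴ * T * B l i * Tᴴ := by rw [h1, Matrix.one_mul]
              _ = Tᴴ * (B k i * T) * Tᴴ := by rw [h3]; simp only [Matrix.mul_assoc]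
              _ = Tᴴ * B k i * (T * Tᴴ) := by simp only [Matrix.mul_assoc]
              _ = Tᴴ * B k i := by rw [h2, Matrix.mul_one]
          trans := by
            rintro k l j ⟨T, h1, h2, h3⟩ ⟨R, h4, h5, h6⟩
            refine ⟨T * R, ?_, ?_, fun i => ?_⟩
            · rw [Matrix.conjTranspose_mul, Matrix.mul_assoc, ← Matrix.mul_assoc Tᴴ, h1,
                Matrix.one_mul, h4]
            · rw [Matrix.conjTranspose_mul, Matrix.mul_assoc, ← Matrix.mul_assoc R, h5,
                Matrix.one_mul, h2]
            · rw [← Matrix.mul_assoc, h3, Matrix.mul_assoc, h6, Matrix.mul_assoc] } }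
  obtain ⟨g, m, e, rep, hm, hrep, hne⟩ := exists_enumeration_classes r
  choose T hT1 hT2 hT3 using hrep
  -- The weights undo the Perron rescalings, and each isometry is twisted by the unitary `T`, so
  -- that all members of a class display the same representative block.
  refine ⟨g, m, fun α => D (rep α), fun α q => (s (e ⟨α, q⟩))⁻¹, fun α => B (rep α),
    fun p => V (e p) * T p.1 p.2, hm, fun α q => inv_pos.2 (hs _), fun α => hB _, hne, ?_, ?_, ?_⟩
  · rintro ⟨α, q⟩
    rw [Matrix.conjTranspose_mul, Matrix.mul_assoc, ← Matrix.mul_assoc _ _ (T α q), hV,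
      Matrix.one_mul, hT1]
  · rintro ⟨α, q⟩ ⟨β, q'⟩ h
    rw [Matrix.conjTranspose_mul, Matrix.mul_assoc, ← Matrix.mul_assoc _ _ (T β q'),
      hVo _ _ (e.injective.ne h), Matrix.zero_mul, Matrix.mul_zero]
  · intro i
    rw [hVs i, ← Equiv.sum_comp e]
    refine Finset.sum_congr rfl ?_
    rintro ⟨α, q⟩ -
    rw [hBV, Matrix.conjTranspose_mul]
    have h1 : B (e ⟨α, q⟩) i = T α q * B (rep α) i * (T α q)ᴴ := by
      rw [← hT3, Matrix.mul_assoc, hT2, Matrix.mul_one]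
    rw [h1]
    simp only [Matrix.mul_smul, Matrix.smul_mul, Matrix.mul_assoc]

end MPDO

theorem mainTheorem9 (d D : ℕ) (M : Fin d → Fin d → Fin D → Fin D → ℂ)
    (hCF : MPDO.IsCanonicalForm (MPDO.horizontal M)) (hM : MPDO.GeneratesMPDO M) :
    MPDO.IsCanonicalForm (MPDO.vertical M) ∧
    ∃ (g : ℕ) (m n : Fin g → ℕ) (μ : (α : Fin g) → Fin (m α) → ℝ)
      (B : (α : Fin g) → MPDO.Tensor (Fin D × Fin D) (Fin (n α)))
      (U : Matrix ((α : Fin g) × (Fin (m α) × Fin (n α))) (Fin d) ℂ),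
      (∀ α, 0 < m α) ∧ (∀ α q, 0 < μ α q) ∧
      MPDO.IsBNT (MPDO.vertical M) B ∧
      U * Uᴴ = 1 ∧
      (∀ p, U * MPDO.vertical M p * Uᴴ =
        Matrix.blockDiagonal' fun α => Matrix.diagonal (fun q => (μ α q : ℂ)) ⊗ₖ B α p) ∧
      (∀ p, MPDO.vertical M p = Uᴴ * (U * MPDO.vertical M p * Uᴴ) * U) := by
  obtain ⟨g, m, n, μ, B, W, hm, hμ, hB, hne, hsum⟩ :=
    (MPDO.posGenerated_vertical M hCF hM).exists_isOrthogonalSum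
  refine ⟨hsum.isCanonicalForm (fun s => by exact_mod_cast (hμ s.1 s.2).ne')
    fun s => (hB s.1).isNormal, ?_⟩
  obtain ⟨U, hU, hAU⟩ := hsum.exists_blockDiagonal
  have hblock : ∀ p, U * MPDO.vertical M p * Uᴴ =
      Matrix.blockDiagonal' fun α => Matrix.diagonal (fun q => (μ α q : ℂ)) ⊗ₖ B α p := by
    intro p
    rw [hAU, ← Matrix.mul_assoc, ← Matrix.mul_assoc, hU, Matrix.one_mul, Matrix.mul_assoc, hU,
      Matrix.mul_one]
  refine ⟨g, m, n, μ, B, U, hm, hμ, ⟨fun j => (hB j).isNormal, fun N hN => ?_,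
    MPDO.exists_linearIndependent_mpv B hB hne⟩, hU, hblock, fun p => ?_⟩
  · rw [hsum.mpv_eq hN]
    exact Submodule.sum_mem _ fun s _ => Submodule.smul_mem _ _
      (Submodule.subset_span (Set.mem_range_self s.1))
  · rw [hblock, ← hAU]
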